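/- **Setting.** Let $K$ streams $X_k=(X_k(n))_{n\ge 1}$, $k\in[K]=\{1,\dots,K\}$, be independent, where $X_k$ has law $\mathrm P_k^1$ if $k$ is a signal and $\mathrm P_k^0$ if it is noise. For $A\subseteq[K]$, $\mathrm P_A$ is the product law when $A$ is the set of signals, and $\mathrm E_A$ is its expectation. Let $\mathcal F_k(n)$ (resp. $\mathcal F(n)$) be the $\sigma$-algebra generated by the first $n$ observations of stream $k$ (resp. of all streams). Assume that $\mathrm P_k^0$ and $\mathrm P_k^1$ are mutually absolutely continuous on $\mathcal F_k(n)$ for all $k,n$, and let $\lambda_k(n)=\log\frac{d\mathrm P_k^1}{d\mathrm P_k^0}(\mathcal F_k(n))$ be the log-likelihood ratio (LLR). Let $\lambda_{(1)}(n)\ge\dots\ge\lambda_{(K)}(n)$ be the ordered LLRs. A sequential multiple testing procedure $\chi=(\mathbf T,\mathbf D)$ consists of $(\mathcal F(n))$-stopping times $T_k\ge 1$ and a set $\mathbf D\subseteq [K]$ of streams identified as signals such that $\{T_k=n,\,k\in\mathbf D\}$ and $\{T_k=n,\,k\notin\mathbf D\}$ belong to $\mathcal F(n)$ for all $k,n$.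 For a class $\Pi$ of subsets of $[K]$ and $\alpha,\beta\in(0,1)$, $\Delta(\alpha,\beta,\Pi)$ is the set of such procedures with, for every $A\in\Pi$, $\mathrm P_A(T_k<\infty)=1$ for all $k$, $\mathrm P_A(\mathbf D\setminus A\ne\emptyset)\le\alpha$ and $\mathrm P_A(A\setminus\mathbf D\neq\emptyset)\le\beta$. Set $\mathcal L_{k,A}(\alpha,\beta,\Pi)=\inf\{\mathrm E_A[T_k]:(\mathbf T,\mathbf D)\in\Delta(\alpha,\beta,\Pi)\}$. Let $0\le l\le u\le K$, $u>0$, $l<K$, and $\Pi_{l,u}=\{A\subseteq[K]: l\le|A|\le u\}$. The proposed procedure $\hat\chi=(\hat{\mathbf T},\hat{\mathbf D})$ with thresholds $a,b,c,d>0$ has $\hat T_k=\min(\hat T_{k,1},\hat T_{k,2})$ and $\hat{\mathbf D}=\{k:\hat T_k=\hat T_{k,1}\}$, where, for $l<u$, $$\hat T_{k,1}=\inf\{n\ge1:\lambda_k(n)\ge\min(a,\lambda_{(l+1)}(n)+c)\},\qquad \hat T_{k,2}=\inf\{n\ge1:\lambda_k(n)\le\max(-b,\lambda_{(u)}(n)-d)\},$$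 and, for $l=u=m$, $$\hat T_{k,1}=\inf\{n\ge1:\lambda_k(n)\ge\lambda_{(m+1)}(n)+c\},\qquad \hat T_{k,2}=\inf\{n\ge1:\lambda_k(n)\le\lambda_{(m)}(n)-d\}.$$ For positive numbers $I_k,J_k$, $k\in[K]$, set $\mathcal I_A=\min_{i\in A}I_i$ and $\mathcal J_A=\min_{j\notin A}J_j$ ($\infty$ over the empty set, with $\infty\cdot0=0$). Write $f\sim g$ if $f/g\to1$ as $\alpha,\beta\downarrow0$ jointly, with no relation between $\alpha$ and $\beta$. **Theorem 4.1.** Suppose that for each $k\in[K]$ there are $I_k,J_k>0$ such that $$\mathrm P_k^1\Big(\limsup_n\tfrac{\lambda_k(n)}n\le I_k\Big)=1,\qquad \mathrm P_k^0\Big(\limsup_n\tfrac{-\lambda_k(n)}n\le J_k\Big)=1,$$ and, for every $\epsilon>0$, $$\sum_{n\ge1}\mathrm P_k^1\Big(\tfrac{\lambda_k(n)}n\le I_k-\epsilon\Big)<\infty,\qquad \sum_{n\ge1}\mathrm P_k^0\Big(\tfrac{-\lambda_k(n)}n\le J_k-\epsilon\Big)<\infty .$$ Let the thresholds $a,b,c,d>0$,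 as functions of $(\alpha,\beta)\in(0,1)^2$, be such that $\hat\chi\in\Delta(\alpha,\beta,\Pi_{l,u})$ for all $\alpha,\beta\in(0,1)$, and $a,c\sim|\log\alpha|$, $b,d\sim|\log\beta|$. Then, for every $A\in\Pi_{l,u}$, $i\in A$ and $j\notin A$, $$\mathrm E_A[\hat T_i]\sim\mathcal L_{i,A}(\alpha,\beta,\Pi_{l,u})\sim\frac{|\log\alpha|}{I_i+\mathcal J_A\mathbf 1\{|A|=l\}},\qquad \mathrm E_A[\hat T_j]\sim\mathcal L_{j,A}(\alpha,\beta,\Pi_{l,u})\sim\frac{|\log\beta|}{J_j+\mathcal I_A\mathbf 1\{|A|=u\}} .$$ Moreover, $\hat\chi\in\Delta(\alpha,\beta,\Pi_{l,u})$ for all $\alpha,\beta\in(0,1)$ with the following choices: if $l=u=m$, $c=|\log\alpha|+\log(m(K-m))$ and $d=|\log\beta|+\log(m(K-m))$; if $l<u$, $a=|\log\alpha|+\log K$, $b=|\log\beta|+\log K$, $c=|\log\alpha|+\log((K-l)K)$ and $d=|\log\beta|+\log(uK)$. -/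

import Mathlib

open MeasureTheory Filter Topology
open scoped ENNReal

noncomputable section

namespace SeqTest

/-! The observations of one stream with values in `S` form a sequence `x : ℕ → S`, in which `x t` is
the observation collected at time `t + 1`; times are `n = 1, 2, …`.  The sample space of `K` streams
is `∀ k, ℕ → S k`. -/

/-- The filtration of a single stream: at time `n`, the σ-algebra generated by its first `n`
observations. -/
def streamFiltration (S : Type*) [MeasurableSpace S] :
    Filtration ℕ (MeasurableSpace.pi : MeasurableSpace (ℕ → S)) where
  seq n := ⨆ (t : ℕ) (_ : t < n), MeasurableSpace.comap (fun x : ℕ → S => x t) inferInstance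
  mono' _ _ hmn := iSup₂_le fun t ht =>
    le_iSup₂ (f := fun (t : ℕ) (_ : t < _) =>
      MeasurableSpace.comap (fun x : ℕ → S => x t) inferInstance) t (lt_of_lt_of_le ht hmn)
  le' _ := iSup₂_le fun t _ => (measurable_pi_apply t).comap_le

section Streams

variable {K : ℕ} {S : Fin K → Type*} [∀ k, MeasurableSpace (S k)]

/-- The global filtration: at time `n`, the σ-algebra generated by the first `n` observations of
all the streams. -/
def globalFiltration (S : Fin K → Type*) [∀ k, MeasurableSpace (S k)] :
    Filtration ℕ (MeasurableSpace.pi : MeasurableSpace (∀ k, ℕ → S k)) where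
  seq n := ⨆ k, MeasurableSpace.comap (fun ω : ∀ k, ℕ → S k => ω k) (streamFiltration (S k) n)
  mono' _ _ hmn := iSup_mono fun k =>
    MeasurableSpace.comap_mono ((streamFiltration (S k)).mono hmn)
  le' n := iSup_le fun k => le_trans
    (MeasurableSpace.comap_mono ((streamFiltration (S k)).le n)) (measurable_pi_apply k).comap_le

/-- The joint distribution `P_A` of the independent streams when `A` is the set of signals:
stream `k` has law `P1 k` if `k ∈ A` and `P0 k` otherwise. -/
def jointLaw (P0 P1 : ∀ k, Measure (ℕ → S k)) (A : Finset (Fin K)) : Measure (∀ k, ℕ → S k) :=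
  Measure.pi fun k => if k ∈ A then P1 k else P0 k

/-- A pair `(T, D)` of decision times, possibly infinite, and of the set of streams that are
identified as signals. -/
structure Procedure (S : Fin K → Type*) where
  T : Fin K → (∀ k, ℕ → S k) → ℕ∞
  D : (∀ k, ℕ → S k) → Set (Fin K)

/-- `χ` is a sequential multiple testing procedure: each `T k` is a stopping time with values in
`{1, 2, …}` (or infinite) and each decision is measurable with respect to the observations
collected by time `T k`. -/
structure Procedure.IsSequential (χ : Procedure S) : Prop where
  one_le : ∀ k ω, 1 ≤ χ.T k ω
  stopping : ∀ k (n : ℕ), MeasurableSet[globalFiltration S n] {ω | χ.T k ω = n}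
  signal : ∀ k (n : ℕ), MeasurableSet[globalFiltration S n] {ω | χ.T k ω = n ∧ k ∈ χ.D ω}
  noise : ∀ k (n : ℕ), MeasurableSet[globalFiltration S n] {ω | χ.T k ω = n ∧ k ∉ χ.D ω}

/-- Type-I familywise error rate when `A` is the set of signals. -/
def FWE1 (P0 P1 : ∀ k, Measure (ℕ → S k)) (χ : Procedure S) (A : Finset (Fin K)) : ℝ≥0∞ :=
  jointLaw P0 P1 A {ω | (χ.D ω \ (A : Set (Fin K))).Nonempty}

/-- Type-II familywise error rate when `A` is the set of signals. -/
def FWE2 (P0 P1 : ∀ k, Measure (ℕ → S k)) (χ : Procedure S) (A : Finset (Fin K)) : ℝ≥0∞ :=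
  jointLaw P0 P1 A {ω | ((A : Set (Fin K)) \ χ.D ω).Nonempty}

/-- The sequential procedures that, for every `A` in the class `Pi`, terminate almost surely in
every stream under `P_A` and have familywise error rates at most `α` and `β`. -/
def errorClass (P0 P1 : ∀ k, Measure (ℕ → S k)) (α β : ℝ) (Pi : Set (Finset (Fin K))) :
    Set (Procedure S) :=
  {χ | χ.IsSequential ∧ ∀ A ∈ Pi, (∀ k, ∀ᵐ ω ∂(jointLaw P0 P1 A), χ.T k ω < ⊤) ∧
    FWE1 P0 P1 χ A ≤ ENNReal.ofReal α ∧ FWE2 P0 P1 χ A ≤ ENNReal.ofReal β}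

/-- The expected decision time `E_A[T k]`, in `[0, ∞]`. -/
def expectedTime (P0 P1 : ∀ k, Measure (ℕ → S k)) (χ : Procedure S) (k : Fin K)
    (A : Finset (Fin K)) : ℝ≥0∞ :=
  ∫⁻ ω, (χ.T k ω : ℝ≥0∞) ∂(jointLaw P0 P1 A)

/-- The optimal expected decision time in stream `k` when `A` is the set of signals. -/
def optimalTime (P0 P1 : ∀ k, Measure (ℕ → S k)) (k : Fin K) (A : Finset (Fin K)) (α β : ℝ)
    (Pi : Set (Finset (Fin K))) : ℝ≥0∞ :=
  ⨅ χ ∈ errorClass P0 P1 α β Pi, expectedTime P0 P1 χ k A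

/-- The sets of signals whose size is between `l` and `u`. -/
def boundedClass (K l u : ℕ) : Set (Finset (Fin K)) := {A | l ≤ A.card ∧ A.card ≤ u}

/-- The laws of a stream under the two hypotheses are mutually absolutely continuous on the
σ-algebra of the first `n` observations, for every `n`. -/
def LocallyEquivalent {S : Type*} [MeasurableSpace S] (P0 P1 : Measure (ℕ → S)) : Prop :=
  ∀ n : ℕ, P1.trim ((streamFiltration S).le n) ≪ P0.trim ((streamFiltration S).le n) ∧
    P0.trim ((streamFiltration S).le n) ≪ P1.trim ((streamFiltration S).le n)

/-- The log-likelihood ratio of a stream at time `n`: the logarithm of the Radon–Nikodym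
derivative of `P1` with respect to `P0`, both restricted to the first `n` observations. -/
def streamLLR {S : Type*} [MeasurableSpace S] (P0 P1 : Measure (ℕ → S)) (n : ℕ) :
    (ℕ → S) → ℝ :=
  llr (P1.trim ((streamFiltration S).le n)) (P0.trim ((streamFiltration S).le n))

/-- The vector of the log-likelihood ratios of all streams at time `n`. -/
def lam (P0 P1 : ∀ k, Measure (ℕ → S k)) (n : ℕ) (ω : ∀ k, ℕ → S k) : Fin K → ℝ :=
  fun k => streamLLR (P0 k) (P1 k) n (ω k)

/-- The `r`-th largest coordinate of `v`, for `1 ≤ r ≤ K` (and `0` for other `r`). -/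
def kthLargest (v : Fin K → ℝ) (r : ℕ) : ℝ :=
  if h : 1 ≤ r ∧ r ≤ K then v (Tuple.sort (fun k => -v k) ⟨r - 1, by omega⟩) else 0

/-- The first time `n ≥ 1` at which `p n` holds; it is infinite if there is none. -/
def firstTime (p : ℕ → Prop) : ℕ∞ := ⨅ (n : ℕ) (_ : 1 ≤ n ∧ p n), (n : ℕ∞)

/-- The time at which the proposed procedure would identify stream `k` as a signal. -/
def signalTime (P0 P1 : ∀ k, Measure (ℕ → S k)) (l u : ℕ) (a c : ℝ) (k : Fin K)
    (ω : ∀ k, ℕ → S k) : ℕ∞ :=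
  if l = u then
    firstTime fun n => kthLargest (lam P0 P1 n ω) (l + 1) + c ≤ lam P0 P1 n ω k
  else
    firstTime fun n => min a (kthLargest (lam P0 P1 n ω) (l + 1) + c) ≤ lam P0 P1 n ω k

/-- The time at which the proposed procedure would identify stream `k` as noise. -/
def noiseTime (P0 P1 : ∀ k, Measure (ℕ → S k)) (l u : ℕ) (b d : ℝ) (k : Fin K)
    (ω : ∀ k, ℕ → S k) : ℕ∞ :=
  if l = u then
    firstTime fun n => lam P0 P1 n ω k ≤ kthLargest (lam P0 P1 n ω) u - d
  else
    firstTime fun n => lam P0 P1 n ω k ≤ max (-b) (kthLargest (lam P0 P1 n ω) u - d)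

/-- The proposed procedure with thresholds `a, b, c, d`, given that the number of signals is between
`l` and `u`.  If `l = u`, then it does not depend on `a` and `b`. -/
def proposed (P0 P1 : ∀ k, Measure (ℕ → S k)) (l u : ℕ) (a b c d : ℝ) : Procedure S where
  T k ω := min (signalTime P0 P1 l u a c k ω) (noiseTime P0 P1 l u b d k ω)
  D ω := {k | min (signalTime P0 P1 l u a c k ω) (noiseTime P0 P1 l u b d k ω)
    = signalTime P0 P1 l u a c k ω}

/-- The one-sided strong laws:
`limsup λ(n) / n ≤ I` `P1`-almost surely and `limsup (-λ(n)) / n ≤ J` `P0`-almost surely. -/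
def LimsupCondition {S : Type*} [MeasurableSpace S] (P0 P1 : Measure (ℕ → S)) (I J : ℝ) : Prop :=
  (∀ᵐ x ∂P1, limsup (fun n : ℕ => ((streamLLR P0 P1 n x / n : ℝ) : EReal)) atTop ≤ (I : EReal)) ∧
  (∀ᵐ x ∂P0, limsup (fun n : ℕ => ((-streamLLR P0 P1 n x / n : ℝ) : EReal)) atTop ≤ (J : EReal))

/-- The one-sided complete convergence of `λ(n) / n` to `I` under `P1` and of `-λ(n) / n` to `J`
under `P0`; the sums are over the times `n + 1 = 1, 2, …`. -/
def CompleteConvergence {S : Type*} [MeasurableSpace S] (P0 P1 : Measure (ℕ → S)) (I J : ℝ) :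
    Prop :=
  ∀ ε : ℝ, 0 < ε →
    (∑' n : ℕ, P1 {x | streamLLR P0 P1 (n + 1) x / ((n + 1 : ℕ) : ℝ) ≤ I - ε} < ⊤) ∧
    (∑' n : ℕ, P0 {x | -streamLLR P0 P1 (n + 1) x / ((n + 1 : ℕ) : ℝ) ≤ J - ε} < ⊤)

end Streams

/-- The minimum of `I i` over `i ∈ A`; it is infinite if `A` is empty. -/
def minSignal {K : ℕ} (I : Fin K → ℝ) (A : Finset (Fin K)) : ℝ≥0∞ :=
  ⨅ i ∈ A, ENNReal.ofReal (I i)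

/-- The minimum of `J j` over `j ∉ A`; it is infinite if there is no such `j`. -/
def minNoise {K : ℕ} (J : Fin K → ℝ) (A : Finset (Fin K)) : ℝ≥0∞ :=
  ⨅ j ∉ A, ENNReal.ofReal (J j)

/-- `α` and `β` tend to `0` from above, independently of each other. -/
def levelsToZero : Filter (ℝ × ℝ) := 𝓝[>] (0 : ℝ) ×ˢ 𝓝[>] (0 : ℝ)

/-- `f ∼ g` as `α, β → 0`, for functions of `(α, β)` with values in `[0, ∞]`: the ratio tends to `1`.
As `∞ / ∞ = 0 / 0 = 0` and `x / 0 = ∞` for `x ≠ 0`, this forces `f` and `g` to be eventually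
positive and finite. -/
def Sim (f g : ℝ → ℝ → ℝ≥0∞) : Prop :=
  Tendsto (fun p : ℝ × ℝ => f p.1 p.2 / g p.1 p.2) levelsToZero (𝓝 1)

/-- `f ∼ g` as `α, β → 0`, for real functions of `(α, β)`. -/
def RealSim (f g : ℝ → ℝ → ℝ) : Prop :=
  Tendsto (fun p : ℝ × ℝ => f p.1 p.2 / g p.1 p.2) levelsToZero (𝓝 1)

end SeqTest

end

open SeqTest

/-! Both asymptotic equivalences come from matching bounds with one common rate `R`.

Lower bound: for a signal `i` in `A`, compare `A` with the nearest admissible `B` that omits `i`.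
This is `A` without `i` if `|A| > l`; if `|A| = l`, removal would leave the class, so `i` is
exchanged for the noise stream with the smallest `J`, which adds that `J` to the rate. Selecting `i`
has probability at most `α` under `P_B`, while missing it has probability at most `β` under `P_A`.
The log-likelihood ratio of `P_A` against `P_B` grows at rate at most `R`, so a change of measure
(`IsLogDensity.measure_le_of_decision`) makes a decision much before `|log α| / R` unlikely. Here
`β` need only be below a fixed constant, hence no relation between the two levels is needed. Noise
streams are symmetric, with `u` in place of `l`.

Upper bound: when no log-likelihood ratio lags its rate by `ε`, the thresholds are passed by about
`h / (R - 2ε)`, where `h` dominates the relevant thresholds. Later delays lie in the events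
`lagSet`, whose probabilities have a finite sum independent of the thresholds
(`expectedTime_proposed_signal_le`, `expectedTime_proposed_noise_le`).

Error control: a wrong decision forces either one log-likelihood ratio across a fixed level or a gap
between a noise stream and a signal. Each is a large value of a likelihood ratio against `P_A`, so
Ville's inequality and a union bound apply. -/

namespace SeqTest

/-! ### Likelihood ratios along a filtration: maximal inequality and change of measure. -/

section General

variable {Ω : Type*} {m0 : MeasurableSpace Ω}

/-- The change of measure from `P` to `Q` along the filtration `ℱ` has log-density `L`. -/
def IsLogDensity (ℱ : Filtration ℕ m0) (P Q : Measure Ω) (L : ℕ → Ω → ℝ) : Prop :=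
  (∀ n, Measurable[ℱ n] (L n)) ∧
    ∀ n E, MeasurableSet[ℱ n] E → Q E = ∫⁻ ω in E, ENNReal.ofReal (Real.exp (L n ω)) ∂P

/-- Ville's inequality for a likelihood ratio. -/
theorem IsLogDensity.measure_exists_le {ℱ : Filtration ℕ m0} {P Q : Measure Ω}
    [IsProbabilityMeasure Q] {L : ℕ → Ω → ℝ} (h : IsLogDensity ℱ P Q L) (c : ℝ) :
    P {ω | ∃ n, c ≤ L n ω} ≤ ENNReal.ofReal (Real.exp (-c)) := by
  set E : ℕ → Set Ω := fun n => {ω | c ≤ L n ω} with hE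
  have hEm : ∀ n, MeasurableSet[ℱ n] (E n) := fun n =>
    measurableSet_le (@measurable_const _ _ _ (ℱ n) _) (h.1 n)
  -- `disjointed E n` says that the level is first reached at time `n`; it is known at time `n`, so
  -- the density `L n` applies to it.
  have hDm : ∀ n, MeasurableSet[ℱ n] (disjointed E n) := fun n => by
    rw [disjointed_eq_inter_compl]
    exact (hEm n).inter (MeasurableSet.iInter fun i => MeasurableSet.iInter fun hi =>
      (ℱ.mono hi.le _ (hEm i)).compl)
  have key : ∀ n, P (disjointed E n) ≤ ENNReal.ofReal (Real.exp (-c)) * Q (disjointed E n) := by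
    intro n
    rw [h.2 n _ (hDm n)]
    have : ENNReal.ofReal (Real.exp c) * P (disjointed E n) ≤
        ∫⁻ ω in disjointed E n, ENNReal.ofReal (Real.exp (L n ω)) ∂P := by
      rw [← setLIntegral_const]
      refine setLIntegral_mono' (ℱ.le n _ (hDm n)) fun ω hω => ?_
      exact ENNReal.ofReal_le_ofReal (Real.exp_le_exp.2 (disjointed_subset E n hω))
    calc P (disjointed E n)
        = ENNReal.ofReal (Real.exp (-c)) *
          (ENNReal.ofReal (Real.exp c) * P (disjointed E n)) := by
          rw [← mul_assoc, ← ENNReal.ofReal_mul (Real.exp_pos _).le, ← Real.exp_add]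
          simp
      _ ≤ _ := by gcongr
  have hU : {ω | ∃ n, c ≤ L n ω} = ⋃ n, disjointed E n := by
    rw [iUnion_disjointed]; ext ω; simp [hE]
  calc P {ω | ∃ n, c ≤ L n ω} ≤ ∑' n, P (disjointed E n) := by
        rw [hU]; exact measure_iUnion_le _
    _ ≤ ∑' n, ENNReal.ofReal (Real.exp (-c)) * Q (disjointed E n) := ENNReal.tsum_le_tsum key
    _ = ENNReal.ofReal (Real.exp (-c)) * Q (⋃ n, disjointed E n) := by
        rw [ENNReal.tsum_mul_left, measure_iUnion (disjoint_disjointed E)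
          fun n => ℱ.le n _ (hDm n)]
    _ ≤ ENNReal.ofReal (Real.exp (-c)) * 1 := by gcongr; exact prob_le_one
    _ = _ := mul_one _

theorem toENNReal_le_tsum (t : ℕ∞) :
    (t : ℝ≥0∞) ≤ ∑' n : ℕ, if (n : ℕ∞) < t then 1 else 0 := by
  induction t using ENat.recTopCoe with
  | top => simp
  | coe m =>
    refine le_trans ?_ (ENNReal.sum_le_tsum (Finset.range m))
    rw [Finset.sum_congr rfl (g := fun _ => (1 : ℝ≥0∞))]
    · simp
    · intro n hn; simp [Finset.mem_range.1 hn]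

/-- If the event that `T` exceeds `n + 1` is contained in `B n` as soon as `n + 1 ≥ M`, then the
expectation of `T` is at most `M + 1 + ∑ P (B n)`. -/
theorem lintegral_le_of_lt_subset (P : Measure Ω) [IsProbabilityMeasure P] (T : Ω → ℕ∞)
    (B : ℕ → Set Ω) (hB : ∀ n, MeasurableSet (B n)) (M : ℕ)
    (h : ∀ n ω, M ≤ n + 1 → ((n + 1 : ℕ) : ℕ∞) < T ω → ω ∈ B n) :
    ∫⁻ ω, (T ω : ℝ≥0∞) ∂P ≤ M + 1 + ∑' n, P (B n) := by
  have hpt : ∀ ω, (T ω : ℝ≥0∞) ≤ (M + 1) + ∑' n, (B n).indicator 1 ω := by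
    intro ω
    refine (toENNReal_le_tsum (T ω)).trans ?_
    -- The term of index `0` pays for the `1`; the term of index `n + 1` is charged to `M` if `n <
    -- M`, and to `B n` otherwise.
    rw [tsum_eq_zero_add' ENNReal.summable, add_comm (M : ℝ≥0∞) 1, add_assoc]
    refine add_le_add (by split_ifs <;> simp) ?_
    have : (M : ℝ≥0∞) = ∑' n : ℕ, if n < M then 1 else 0 := by
      rw [tsum_eq_sum (s := Finset.range M)]
      · rw [Finset.sum_congr rfl (g := fun _ => (1 : ℝ≥0∞))]
        · simp
        · intro n hn; simp [Finset.mem_range.1 hn]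
      · intro n hn; simpa using hn
    rw [this, ← ENNReal.tsum_add]
    refine ENNReal.tsum_le_tsum fun n => ?_
    by_cases hn : n < M
    · rw [if_pos hn]; refine le_trans ?_ le_self_add; split_ifs <;> simp
    · split_ifs with hT
      · have := h n ω (by omega) hT
        simp [this]
      · simp
  calc ∫⁻ ω, (T ω : ℝ≥0∞) ∂P ≤ ∫⁻ ω, ((M + 1) + ∑' n, (B n).indicator 1 ω) ∂P :=
        lintegral_mono hpt
    _ = _ := by
        rw [lintegral_add_left measurable_const, lintegral_tsum fun n =>
          (measurable_one.indicator (hB n)).aemeasurable]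
        simp [lintegral_indicator_one (hB _)]

/-- Almost surely only finitely many `n` violate the linear bound, so the excess over `r * n` has a
finite supremum. This gives control of all times at once for the price of an additive constant. -/
theorem tendsto_measure_exists_gt (P : Measure Ω) [IsProbabilityMeasure P] (L : ℕ → Ω → ℝ)
    (hL : ∀ n, Measurable (L n)) (r : ℝ)
    (hlim : ∀ᵐ ω ∂P, ∀ᶠ n : ℕ in atTop, L n ω ≤ r * n) :
    Tendsto (fun k : ℕ => P {ω | ∃ n : ℕ, r * n + k < L n ω}) atTop (𝓝 0) := by
  have hm : ∀ k : ℕ, MeasurableSet {ω | ∃ n : ℕ, r * n + k < L n ω} := fun k => by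
    rw [Set.ofPred_exists]
    exact MeasurableSet.iUnion fun n => measurableSet_lt measurable_const (hL n)
  have h0 : P (⋂ k : ℕ, {ω | ∃ n : ℕ, r * n + k < L n ω}) = 0 := by
    refine measure_mono_null ?_ hlim
    intro ω hω hev
    obtain ⟨n0, hn0⟩ := eventually_atTop.1 hev
    obtain ⟨k, hk⟩ := exists_nat_ge (∑ n ∈ Finset.range n0, |L n ω - r * n|)
    obtain ⟨n, hn⟩ := Set.mem_iInter.1 hω k
    have hk0 : (0 : ℝ) ≤ k := Nat.cast_nonneg k
    by_cases hlt : n < n0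
    · have := Finset.single_le_sum (f := fun n : ℕ => |L n ω - r * n|)
        (fun i _ => abs_nonneg _) (Finset.mem_range.2 hlt)
      have h2 := le_abs_self (L n ω - r * n)
      linarith
    · have := hn0 n (not_lt.1 hlt)
      linarith
  rw [← h0]
  refine tendsto_measure_iInter_atTop (fun k => (hm k).nullMeasurableSet) ?_
    ⟨0, measure_ne_top _ _⟩
  intro k k' hkk ω ⟨n, hn⟩
  refine ⟨n, lt_of_le_of_lt ?_ hn⟩
  have : (k : ℝ) ≤ k' := Nat.cast_le.2 hkk
  linarith

/-- The change-of-measure bound: a decision made by time `N`, whose probability is small under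
`Q`, has small probability under `P` unless the log-likelihood ratio is large. -/
theorem IsLogDensity.measure_le_of_decision {ℱ : Filtration ℕ m0} {P Q : Measure Ω}
    {L : ℕ → Ω → ℝ} (h : IsLogDensity ℱ Q P L) (T : Ω → ℕ∞) (G : Set Ω)
    (hTG : ∀ n : ℕ, MeasurableSet[ℱ n] {ω | T ω = n ∧ ω ∈ G}) (N : ℕ) (C : ℝ) :
    P {ω | T ω ≤ N} ≤ P Gᶜ + P {ω | ∃ n ≤ N, C < L n ω} +
      ENNReal.ofReal (Real.exp C) * Q G := by
  set E : ℕ → Set Ω := fun n => {ω | T ω = n ∧ ω ∈ G}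
  have hEdisj : Pairwise (Function.onFun Disjoint E) := by
    intro i j hij
    refine Set.disjoint_left.2 fun ω hi hj => hij ?_
    exact_mod_cast hi.1.symm.trans hj.1
  -- Where the log-density at the decision time is at most `C`, changing measure costs a factor of
  -- at most `exp C`.
  have key : ∀ n, P (E n ∩ {ω | L n ω ≤ C}) ≤ ENNReal.ofReal (Real.exp C) * Q (E n) := by
    intro n
    have hm : MeasurableSet[ℱ n] (E n ∩ {ω | L n ω ≤ C}) :=
      (hTG n).inter (measurableSet_le (h.1 n) (@measurable_const _ _ _ (ℱ n) _))
    rw [h.2 n _ hm]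
    calc _ ≤ ∫⁻ ω in E n ∩ {ω | L n ω ≤ C}, ENNReal.ofReal (Real.exp C) ∂Q :=
          setLIntegral_mono' (ℱ.le n _ hm) fun ω hω =>
            ENNReal.ofReal_le_ofReal (Real.exp_le_exp.2 hω.2)
      _ = ENNReal.ofReal (Real.exp C) * Q (E n ∩ {ω | L n ω ≤ C}) := setLIntegral_const _ _
      _ ≤ _ := by gcongr; exact Set.inter_subset_left
  have hsub : {ω | T ω ≤ N} ⊆ (Gᶜ ∪ {ω | ∃ n ≤ N, C < L n ω}) ∪
      ⋃ n, (E n ∩ {ω | L n ω ≤ C}) := by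
    intro ω hω
    by_cases hG : ω ∈ G
    · by_cases hL : ∃ n ≤ N, C < L n ω
      · exact Or.inl (Or.inr hL)
      · push Not at hL
        obtain ⟨n, hn⟩ := ENat.ne_top_iff_exists.1 (ne_top_of_le_ne_top (ENat.natCast_ne_top N) hω)
        have hnN : n ≤ N := by
          have : (n : ℕ∞) ≤ N := hn ▸ hω
          exact_mod_cast this
        exact Or.inr (Set.mem_iUnion.2 ⟨n, ⟨hn.symm, hG⟩, hL n hnN⟩)
    · exact Or.inl (Or.inl hG)
  refine (measure_mono hsub).trans ((measure_union_le _ _).trans ?_)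
  refine add_le_add (measure_union_le _ _) ?_
  calc P (⋃ n, (E n ∩ {ω | L n ω ≤ C})) ≤ ∑' n, P (E n ∩ {ω | L n ω ≤ C}) :=
        measure_iUnion_le _
    _ ≤ ∑' n, ENNReal.ofReal (Real.exp C) * Q (E n) := ENNReal.tsum_le_tsum key
    _ = ENNReal.ofReal (Real.exp C) * ∑' n, Q (E n) := ENNReal.tsum_mul_left
    _ ≤ _ := by
        gcongr
        refine (tsum_meas_le_meas_iUnion_of_disjoint Q (fun n => ℱ.le n _ (hTG n)) hEdisj).trans ?_
        exact measure_mono (Set.iUnion_subset fun n ω hω => hω.2)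

/-- Asymptotic lower bound for the expected time of a decision that has probability at least
`1 - δ` under `P` and at most `exp (-x)` under `Q`. -/
theorem IsLogDensity.exists_lintegral_ge {ℱ : Filtration ℕ m0} {P Q : Measure Ω}
    [IsProbabilityMeasure P] {L : ℕ → Ω → ℝ} (h : IsLogDensity ℱ Q P L) {R : ℝ} (hR : 0 < R)
    (hlim : ∀ r, R < r → ∀ᵐ ω ∂P, ∀ᶠ n : ℕ in atTop, L n ω ≤ r * n)
    {ε : ℝ} (hε : 0 < ε) (hε1 : ε < 1) :
    ∃ x0 δ : ℝ, 0 < δ ∧ ∀ x ≥ x0, ∀ (T : Ω → ℕ∞) (G : Set Ω), Measurable T →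
      (∀ n : ℕ, MeasurableSet[ℱ n] {ω | T ω = n ∧ ω ∈ G}) →
      Q G ≤ ENNReal.ofReal (Real.exp (-x)) → P Gᶜ ≤ ENNReal.ofReal δ →
      ENNReal.ofReal ((1 - ε) * x / R) ≤ ∫⁻ ω, (T ω : ℝ≥0∞) ∂P := by
  -- With these values `3 * δ = η`, and `(1 - η) * (1 - 3 * δ) = (1 - η) ^ 2 ≥ 1 - ε`.
  set η := ε / 2 with hη
  set δ := ε / 6 with hδ
  have hδ0 : 0 < δ := by positivity
  have hη0 : 0 < η := by positivity
  have hrR : R < R * (1 + η) := by nlinarith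
  have ht := tendsto_measure_exists_gt P L (fun n => (h.1 n).mono (ℱ.le n) le_rfl) _ (hlim _ hrR)
  obtain ⟨k, hk⟩ := (ht.eventually_le_const (u := ENNReal.ofReal δ) (by simpa using hδ0)).exists
  have ht2 : Tendsto (fun x : ℝ => η ^ 2 / 2 * x) atTop atTop :=
    tendsto_id.const_mul_atTop (by positivity)
  have ht3 : Tendsto (fun x : ℝ => Real.exp (-(η ^ 2 / 2 * x))) atTop (𝓝 0) :=
    Real.tendsto_exp_neg_atTop_nhds_zero.comp ht2
  obtain ⟨x0, hx0⟩ := eventually_atTop.1 ((ht2.eventually_ge_atTop (k : ℝ)).and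
    ((ht3.eventually_le_const hδ0).and (eventually_ge_atTop 0)))
  refine ⟨x0, δ, hδ0, fun x hx T G hTm hTG hQG hPG => ?_⟩
  obtain ⟨hxk, hxe, hx0⟩ := hx0 x hx
  -- Up to time `N` the linear bound is at most `(1 - η ^ 2) * x`. The cut-off `C = (1 - η ^ 2 / 2)
  -- * x` leaves a margin `η ^ 2 / 2 * x` on each side: below it to absorb `k`, above it to make
  -- `exp (C - x)` small.
  set N := ⌊(1 - η) * x / R⌋₊ with hN
  have hN0 : 0 ≤ (1 - η) * x / R := by
    have : 0 ≤ 1 - η := by linarith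
    positivity
  have hNle : (N : ℝ) ≤ (1 - η) * x / R := Nat.floor_le hN0
  have hRN : R * (1 + η) * N ≤ (1 - η ^ 2) * x := by
    calc R * (1 + η) * N ≤ R * (1 + η) * ((1 - η) * x / R) := by gcongr
      _ = _ := by field_simp; ring
  have hmain : P {ω | T ω ≤ N} ≤ ENNReal.ofReal (3 * δ) := by
    refine (h.measure_le_of_decision T G hTG N ((1 - η ^ 2 / 2) * x)).trans ?_
    have e3 : ENNReal.ofReal (3 * δ) =
        ENNReal.ofReal δ + ENNReal.ofReal δ + ENNReal.ofReal δ := by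
      rw [← ENNReal.ofReal_add hδ0.le hδ0.le, ← ENNReal.ofReal_add (by positivity) hδ0.le]
      ring_nf
    rw [e3]
    refine add_le_add (add_le_add hPG ?_) ?_
    · refine le_trans (measure_mono ?_) hk
      rintro ω ⟨n, hn, hL⟩
      refine ⟨n, lt_of_le_of_lt ?_ hL⟩
      have : R * (1 + η) * n ≤ R * (1 + η) * N := by gcongr
      nlinarith
    · calc _ ≤ ENNReal.ofReal (Real.exp ((1 - η ^ 2 / 2) * x)) * ENNReal.ofReal (Real.exp (-x)) := by
            gcongr
        _ = ENNReal.ofReal (Real.exp (-(η ^ 2 / 2 * x))) := by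
            rw [← ENNReal.ofReal_mul (Real.exp_pos _).le, ← Real.exp_add]; ring_nf
        _ ≤ _ := ENNReal.ofReal_le_ofReal hxe
  have hgt : ENNReal.ofReal (1 - 3 * δ) ≤ P {ω | ((N + 1 : ℕ) : ℝ≥0∞) ≤ (T ω : ℝ≥0∞)} := by
    have hs : {ω | ((N + 1 : ℕ) : ℝ≥0∞) ≤ (T ω : ℝ≥0∞)} = {ω | T ω ≤ N}ᶜ := by
      ext ω
      have e : ((N + 1 : ℕ) : ℝ≥0∞) = (((N + 1 : ℕ) : ℕ∞) : ℝ≥0∞) := by simp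
      simp only [Set.mem_ofPred_eq, Set.mem_compl_iff, not_le]
      rw [e, ENat.toENNReal_le]
      rw [Nat.cast_add, Nat.cast_one, ENat.add_one_le_iff (ENat.natCast_ne_top N)]
    have hTN : MeasurableSet {ω | T ω ≤ N} := hTm (Set.to_countable (Set.Iic (N : ℕ∞))).measurableSet
    rw [hs, prob_compl_eq_one_sub hTN,
      ENNReal.ofReal_sub _ (by positivity), ENNReal.ofReal_one]
    gcongr
  have hTm' : Measurable fun ω => (T ω : ℝ≥0∞) :=
    (measurable_of_countable (fun t : ℕ∞ => (t : ℝ≥0∞))).comp hTm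
  refine le_trans ?_ (mul_meas_ge_le_lintegral hTm' ((N + 1 : ℕ) : ℝ≥0∞))
  have hN1 : (1 - η) * x / R ≤ (N + 1 : ℕ) := by push_cast; exact (Nat.lt_floor_add_one _).le
  calc ENNReal.ofReal ((1 - ε) * x / R)
      ≤ ENNReal.ofReal ((1 - η) * x / R * (1 - 3 * δ)) := by
        apply ENNReal.ofReal_le_ofReal
        have : (1 - η) * x / R * (1 - 3 * δ) = ((1 - η) * (1 - 3 * δ)) * x / R := by ring
        rw [this]
        gcongr
        have : 3 * δ = η := by rw [hδ, hη]; ring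
        rw [this]; nlinarith
    _ = ENNReal.ofReal ((1 - η) * x / R) * ENNReal.ofReal (1 - 3 * δ) :=
        ENNReal.ofReal_mul hN0
    _ ≤ ENNReal.ofReal ((N + 1 : ℕ) : ℝ) * ENNReal.ofReal (1 - 3 * δ) := by gcongr
    _ ≤ _ := by rw [ENNReal.ofReal_natCast]; gcongr

end General

/-! ### Order statistics through counting. -/

section OrderStatistics

variable {K : ℕ}

/-- The sorting permutation preserves the number of coordinates above `x`. Later facts on order
statistics follow from this count or its strict version. -/
theorem le_kthLargest_iff (v : Fin K → ℝ) {r : ℕ} (h1 : 1 ≤ r) (hK : r ≤ K) (x : ℝ) :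
    x ≤ kthLargest v r ↔ r ≤ (Finset.univ.filter fun k => x ≤ v k).card := by
  have hs := Tuple.monotone_sort (fun k => -v k)
  have := Tuple.lt_card_le_iff_apply_le_of_monotone (j := ⟨r - 1, by omega⟩) (a := -x) hs
  simp only [Function.comp, neg_le_neg_iff] at this
  rw [kthLargest, dif_pos ⟨h1, hK⟩, ← this,
    ← Finset.card_map (Tuple.sort fun k => -v k).toEmbedding]
  have : Finset.map (Tuple.sort fun k => -v k).toEmbedding
      (Finset.univ.filter fun i => x ≤ v ((Tuple.sort fun k => -v k) i)) =
      Finset.univ.filter fun k => x ≤ v k := by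
    ext k
    simp only [Finset.mem_map, Finset.mem_filter, Finset.mem_univ, true_and]
    exact ⟨by rintro ⟨i, hi, rfl⟩; exact hi, fun hk =>
      ⟨(Tuple.sort fun k => -v k).symm k, by simpa using hk, by simp⟩⟩
  rw [this]
  omega

theorem lt_kthLargest_iff (v : Fin K → ℝ) {r : ℕ} (h1 : 1 ≤ r) (hK : r ≤ K) (x : ℝ) :
    x < kthLargest v r ↔ r ≤ (Finset.univ.filter fun k => x < v k).card := by
  have hs := Tuple.monotone_sort (fun k => -v k)
  have := Tuple.lt_card_lt_iff_apply_lt_of_monotone (j := ⟨r - 1, by omega⟩) (a := -x) hs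
  simp only [Function.comp, neg_lt_neg_iff] at this
  rw [kthLargest, dif_pos ⟨h1, hK⟩, ← this,
    ← Finset.card_map (Tuple.sort fun k => -v k).toEmbedding]
  have : Finset.map (Tuple.sort fun k => -v k).toEmbedding
      (Finset.univ.filter fun i => x < v ((Tuple.sort fun k => -v k) i)) =
      Finset.univ.filter fun k => x < v k := by
    ext k
    simp only [Finset.mem_map, Finset.mem_filter, Finset.mem_univ, true_and]
    exact ⟨by rintro ⟨i, hi, rfl⟩; exact hi, fun hk =>
      ⟨(Tuple.sort fun k => -v k).symm k, by simpa using hk, by simp⟩⟩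
  rw [this]
  omega

theorem kthLargest_le {v : Fin K → ℝ} {A : Finset (Fin K)} {y : ℝ} {r : ℕ} (hr : A.card < r)
    (hK : r ≤ K) (h : ∀ j ∉ A, v j ≤ y) : kthLargest v r ≤ y := by
  by_contra! hlt
  have := (lt_kthLargest_iff v (by omega) hK y).1 hlt
  have hsub : (Finset.univ.filter fun k => y < v k) ⊆ A := fun k hk => by
    by_contra hkA
    exact absurd (h k hkA) (not_le.2 (Finset.mem_filter.1 hk).2)
  have := Finset.card_le_card hsub
  omega

theorem le_kthLargest {v : Fin K → ℝ} {A : Finset (Fin K)} {y : ℝ} {r : ℕ} (h1 : 1 ≤ r)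
    (hr : r ≤ A.card) (h : ∀ i ∈ A, y ≤ v i) : y ≤ kthLargest v r := by
  have hAK : A.card ≤ K := by simpa using Finset.card_le_univ A
  rw [le_kthLargest_iff v h1 (by omega)]
  refine hr.trans (Finset.card_le_card fun k hk => ?_)
  simpa using h k hk

/-- Otherwise all of `insert k A`, at least `l + 1` coordinates, would exceed `v k - c`, and so
would the `(l + 1)`-th largest. A rule on order statistics thus becomes a comparison of two streams.
-/
theorem exists_mem_of_kthLargest_add_le {v : Fin K → ℝ} {A : Finset (Fin K)} {k : Fin K}
    (hk : k ∉ A) {l : ℕ} (hl : l ≤ A.card) {c : ℝ} (hc : 0 < c)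
    (h : kthLargest v (l + 1) + c ≤ v k) : ∃ i ∈ A, c ≤ v k - v i := by
  by_contra! hA
  have hcard : (insert k A).card = A.card + 1 := Finset.card_insert_of_notMem hk
  have hK : (insert k A).card ≤ K := by simpa using Finset.card_le_univ (insert k A)
  have hlt : v k - c < kthLargest v (l + 1) := by
    rw [lt_kthLargest_iff v (by omega) (by omega)]
    calc l + 1 ≤ (insert k A).card := by omega
      _ ≤ _ := Finset.card_le_card fun i hi => by
        rcases Finset.mem_insert.1 hi with rfl | hi
        · simpa using hc
        · have := hA i hi
          simp only [Finset.mem_filter, Finset.mem_univ, true_and]; linarith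
  linarith

/-- Otherwise the coordinates reaching `v k + d` would all lie in `A.erase k`, which has fewer than
`u` elements. -/
theorem exists_notMem_of_le_kthLargest_sub {v : Fin K → ℝ} {A : Finset (Fin K)} {k : Fin K}
    (hk : k ∈ A) {u : ℕ} (hu : A.card ≤ u) (huK : u ≤ K) {d : ℝ} (hd : 0 < d)
    (h : v k ≤ kthLargest v u - d) : ∃ j ∉ A, d ≤ v j - v k := by
  by_contra! hA
  have hpos : 0 < A.card := Finset.card_pos.2 ⟨k, hk⟩
  have hle : v k + d ≤ kthLargest v u := by linarith
  rw [le_kthLargest_iff v (by omega) huK] at hle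
  have hsub : (Finset.univ.filter fun i => v k + d ≤ v i) ⊆ A.erase k := fun i hi => by
    have hi' := (Finset.mem_filter.1 hi).2
    refine Finset.mem_erase.2 ⟨?_, ?_⟩
    · rintro rfl; linarith
    · by_contra hiA
      have := hA i hiA
      linarith
  have := Finset.card_le_card hsub
  rw [Finset.card_erase_of_mem hk] at this
  omega

theorem measurable_kthLargest (r : ℕ) : Measurable fun v : Fin K → ℝ => kthLargest v r := by
  by_cases hr : 1 ≤ r ∧ r ≤ K
  · refine measurable_of_Ici fun x => ?_
    have : (fun v : Fin K → ℝ => kthLargest v r) ⁻¹' Set.Ici x =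
        {v | r ≤ ∑ k, if x ≤ v k then 1 else 0} := by
      ext v
      rw [Set.mem_preimage, Set.mem_Ici, le_kthLargest_iff v hr.1 hr.2, Finset.card_filter]
      rfl
    rw [this]
    refine measurableSet_le measurable_const (Finset.measurable_sum _ fun k _ => ?_)
    exact Measurable.ite (measurableSet_le measurable_const (measurable_pi_apply k))
      measurable_const measurable_const
  · simp only [kthLargest, dif_neg hr]
    exact measurable_const

end OrderStatistics

/-! ### First passage times and their measurability. -/

section FirstTime

theorem firstTime_le_iff (p : ℕ → Prop) (n : ℕ) :
    firstTime p ≤ n ↔ ∃ m ≤ n, 1 ≤ m ∧ p m := by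
  constructor
  · intro h
    by_contra! hp
    have : ((n + 1 : ℕ) : ℕ∞) ≤ firstTime p := le_iInf₂ fun m hm => by
      by_contra! hlt
      have hlt' : m < n + 1 := by exact_mod_cast hlt
      exact hp m (by omega) hm.1 hm.2
    have := this.trans h
    have : n + 1 ≤ n := by exact_mod_cast this
    omega
  · rintro ⟨m, hm, h1, hp⟩
    exact (iInf₂_le m ⟨h1, hp⟩).trans (by exact_mod_cast hm)

theorem one_le_firstTime (p : ℕ → Prop) : 1 ≤ firstTime p :=
  le_iInf₂ fun m hm => by exact_mod_cast hm.1

theorem exists_of_firstTime_ne_top {p : ℕ → Prop} (h : firstTime p ≠ ⊤) : ∃ n, p n := by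
  obtain ⟨n, hn⟩ := ENat.ne_top_iff_exists.1 h
  obtain ⟨m, -, -, hm⟩ := (firstTime_le_iff p n).1 hn.symm.le
  exact ⟨m, hm⟩

theorem not_of_lt_firstTime {p : ℕ → Prop} {n : ℕ} (h1 : 1 ≤ n) (h : (n : ℕ∞) < firstTime p) :
    ¬ p n := fun hp => absurd ((firstTime_le_iff p n).2 ⟨n, le_rfl, h1, hp⟩) (not_le.2 h)

/-- The events `{τ ≤ n}` of a random time belong to the filtration. -/
def IsOptional {Ω : Type*} {m0 : MeasurableSpace Ω} (ℱ : Filtration ℕ m0) (τ : Ω → ℕ∞) : Prop :=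
  ∀ n : ℕ, MeasurableSet[ℱ n] {ω | τ ω ≤ n}

variable {Ω : Type*} {m0 : MeasurableSpace Ω} {ℱ : Filtration ℕ m0}

theorem isOptional_firstTime {p : ℕ → Ω → Prop} (hp : ∀ n, MeasurableSet[ℱ n] {ω | p n ω}) :
    IsOptional ℱ fun ω => firstTime fun n => p n ω := by
  intro n
  have : {ω | (firstTime fun n => p n ω) ≤ n} = ⋃ m ∈ {m | m ≤ n ∧ 1 ≤ m}, {ω | p m ω} := by
    ext ω
    simp [firstTime_le_iff, and_assoc]
  rw [this]
  exact MeasurableSet.biUnion (Set.to_countable _) fun m hm => ℱ.mono hm.1 _ (hp m)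

theorem IsOptional.measurableSet_lt {τ : Ω → ℕ∞} (h : IsOptional ℱ τ) (n : ℕ) :
    MeasurableSet[ℱ n] {ω | τ ω < n} := by
  have : {ω | τ ω < n} = ⋃ m ∈ {m : ℕ | m < n}, {ω | τ ω ≤ m} := by
    ext ω
    simp only [Set.mem_ofPred_eq, Set.mem_iUnion, exists_prop]
    constructor
    · intro hlt
      obtain ⟨m, hm⟩ := ENat.ne_top_iff_exists.1 hlt.ne_top
      exact ⟨m, by rw [← hm] at hlt; exact_mod_cast hlt, hm.symm.le⟩
    · rintro ⟨m, hm, hle⟩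
      exact lt_of_le_of_lt hle (by exact_mod_cast hm)
  rw [this]
  exact MeasurableSet.biUnion (Set.to_countable _) fun m hm => ℱ.mono (le_of_lt hm) _ (h m)

theorem measurable_of_measurableSet_eq {T : Ω → ℕ∞}
    (h : ∀ n : ℕ, MeasurableSet {ω | T ω = n}) : Measurable T := by
  refine measurable_to_countable' fun t => ?_
  induction t using ENat.recTopCoe with
  | coe n => exact h n
  | top =>
    have : T ⁻¹' {⊤} = (⋃ n : ℕ, {ω | T ω = n})ᶜ := by
      ext ω
      simp only [Set.mem_preimage, Set.mem_singleton_iff, Set.mem_compl_iff, Set.mem_iUnion,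
        Set.mem_ofPred_eq, not_exists]
      constructor
      · intro h n hn; rw [h] at hn; exact ENat.natCast_ne_top n hn.symm
      · intro h
        by_contra hne
        obtain ⟨n, hn⟩ := ENat.ne_top_iff_exists.1 hne
        exact h n hn.symm
    rw [this]
    exact (MeasurableSet.iUnion h).compl

end FirstTime

/-! ### Joint laws and their likelihood ratios. -/

section Laws

variable {K : ℕ} {S : Fin K → Type*} [∀ k, MeasurableSpace (S k)]
variable (P0 P1 : ∀ k, Measure (ℕ → S k))

instance isProbabilityMeasure_ite [∀ k, IsProbabilityMeasure (P0 k)]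
    [∀ k, IsProbabilityMeasure (P1 k)] (A : Finset (Fin K)) (k : Fin K) :
    IsProbabilityMeasure (if k ∈ A then P1 k else P0 k) := by
  split_ifs <;> infer_instance

instance isProbabilityMeasure_jointLaw [∀ k, IsProbabilityMeasure (P0 k)]
    [∀ k, IsProbabilityMeasure (P1 k)] (A : Finset (Fin K)) :
    IsProbabilityMeasure (jointLaw P0 P1 A) := by
  unfold jointLaw; infer_instance

theorem measurePreserving_jointLaw_of_mem [∀ k, IsProbabilityMeasure (P0 k)]
    [∀ k, IsProbabilityMeasure (P1 k)] {A : Finset (Fin K)} {k : Fin K} (hk : k ∈ A) :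
    MeasurePreserving (fun ω : ∀ k, ℕ → S k => ω k) (jointLaw P0 P1 A) (P1 k) := by
  have := measurePreserving_eval (fun k => if k ∈ A then P1 k else P0 k) k
  rwa [if_pos hk] at this

theorem measurePreserving_jointLaw_of_notMem [∀ k, IsProbabilityMeasure (P0 k)]
    [∀ k, IsProbabilityMeasure (P1 k)] {A : Finset (Fin K)} {k : Fin K} (hk : k ∉ A) :
    MeasurePreserving (fun ω : ∀ k, ℕ → S k => ω k) (jointLaw P0 P1 A) (P0 k) := by
  have := measurePreserving_eval (fun k => if k ∈ A then P1 k else P0 k) k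
  rwa [if_neg hk] at this

theorem measurable_streamLLR {S : Type*} [MeasurableSpace S] (P0 P1 : Measure (ℕ → S)) (n : ℕ) :
    Measurable[streamFiltration S n] (streamLLR P0 P1 n) :=
  measurable_llr _ _

theorem comap_le_globalFiltration (n : ℕ) (k : Fin K) :
    MeasurableSpace.comap (fun ω : ∀ k, ℕ → S k => ω k) (streamFiltration (S k) n) ≤
      globalFiltration S n :=
  le_iSup (fun k => MeasurableSpace.comap (fun ω : ∀ k, ℕ → S k => ω k)
    (streamFiltration (S k) n)) k

theorem measurable_lam (n : ℕ) (k : Fin K) :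
    Measurable[globalFiltration S n] fun ω => lam P0 P1 n ω k := by
  have : Measurable[globalFiltration S n, streamFiltration (S k) n]
      fun ω : ∀ k, ℕ → S k => ω k :=
    measurable_iff_comap_le.2 (comap_le_globalFiltration n k)
  exact (measurable_streamLLR (P0 k) (P1 k) n).comp this

theorem measurable_lam_vec (n : ℕ) : Measurable[globalFiltration S n] (lam P0 P1 n) :=
  @measurable_pi_lambda _ _ _ (globalFiltration S n) _ _ fun k => measurable_lam P0 P1 n k

section SingleStream

variable {S : Type*} [MeasurableSpace S] {P0 P1 : Measure (ℕ → S)}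
  [IsProbabilityMeasure P0] [IsProbabilityMeasure P1]

theorem measure_eq_setLIntegral_exp_streamLLR (h : LocallyEquivalent P0 P1) (n : ℕ)
    {E : Set (ℕ → S)} (hE : MeasurableSet[streamFiltration S n] E) :
    P1 E = ∫⁻ x in E, ENNReal.ofReal (Real.exp (streamLLR P0 P1 n x)) ∂P0 := by
  have hle := (streamFiltration S).le n
  have hm : Measurable[streamFiltration S n]
      fun x => ENNReal.ofReal (Real.exp (streamLLR P0 P1 n x)) :=
    (Real.measurable_exp.comp (measurable_streamLLR P0 P1 n)).ennreal_ofReal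
  rw [← setLIntegral_trim hle hm hE, ← trim_measurableSet_eq hle hE,
    ← Measure.setLIntegral_rnDeriv (h n).1]
  refine setLIntegral_congr_fun_ae hE ?_
  -- Both directions of equivalence are needed: `(h n).1` provides the density, and `(h n).2` makes
  -- it nonzero almost everywhere, which excludes the default value `Real.log 0 = 0`.
  filter_upwards [exp_llr_of_ac' (P1.trim hle) (P0.trim hle) (h n).2,
    Measure.rnDeriv_lt_top (P1.trim hle) (P0.trim hle)] with x hx hx' _
  rw [streamLLR, hx, ENNReal.ofReal_toReal hx'.ne]

theorem measure_eq_setLIntegral_exp_neg_streamLLR (h : LocallyEquivalent P0 P1) (n : ℕ)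
    {E : Set (ℕ → S)} (hE : MeasurableSet[streamFiltration S n] E) :
    P0 E = ∫⁻ x in E, ENNReal.ofReal (Real.exp (-streamLLR P0 P1 n x)) ∂P1 := by
  have hle := (streamFiltration S).le n
  have hm : Measurable[streamFiltration S n]
      fun x => ENNReal.ofReal (Real.exp (-streamLLR P0 P1 n x)) :=
    (Real.measurable_exp.comp (measurable_streamLLR P0 P1 n).neg).ennreal_ofReal
  rw [← setLIntegral_trim hle hm hE, ← trim_measurableSet_eq hle hE,
    ← Measure.setLIntegral_rnDeriv (h n).2]
  refine setLIntegral_congr_fun_ae hE ?_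
  filter_upwards [exp_neg_llr (h n).1,
    Measure.rnDeriv_lt_top (P0.trim hle) (P1.trim hle)] with x hx hx' _
  rw [streamLLR, hx, ENNReal.ofReal_toReal hx'.ne]

end SingleStream

/-- The log-likelihood ratio of `P_B` against `P_A` at time `n`. -/
noncomputable def logLR (A B : Finset (Fin K)) (n : ℕ) (ω : ∀ k, ℕ → S k) : ℝ :=
  ∑ k, ((if k ∈ B then 1 else 0) - (if k ∈ A then 1 else 0)) * lam P0 P1 n ω k

theorem logLR_insert {A : Finset (Fin K)} {k : Fin K} (hk : k ∉ A) (n : ℕ)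
    (ω : ∀ k, ℕ → S k) : logLR P0 P1 A (insert k A) n ω = lam P0 P1 n ω k := by
  rw [logLR, Finset.sum_eq_single k]
  · simp [hk]
  · intro i _ hi; simp [hi]
  · simp

theorem logLR_erase {A : Finset (Fin K)} {k : Fin K} (hk : k ∈ A) (n : ℕ)
    (ω : ∀ k, ℕ → S k) : logLR P0 P1 A (A.erase k) n ω = -lam P0 P1 n ω k := by
  rw [logLR, Finset.sum_eq_single k]
  · simp [hk]
  · intro i _ hi; simp [hi]
  · simp

/-- A swap preserves the cardinality, so it stays in the class even at the extreme sizes `l` and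
`u`. -/
theorem logLR_swap {A : Finset (Fin K)} {i j : Fin K} (hi : i ∈ A) (hj : j ∉ A) (n : ℕ)
    (ω : ∀ k, ℕ → S k) :
    logLR P0 P1 A (insert j (A.erase i)) n ω = lam P0 P1 n ω j - lam P0 P1 n ω i := by
  have hij : i ≠ j := fun h => hj (h ▸ hi)
  rw [logLR, Finset.sum_eq_add j i hij.symm]
  · simp [hi, hj, hij]; ring
  · intro k _ hk; simp [hk.1, hk.2]
  · simp
  · simp

theorem logLR_symm (A B : Finset (Fin K)) (n : ℕ) (ω : ∀ k, ℕ → S k) :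
    logLR P0 P1 B A n ω = -logLR P0 P1 A B n ω := by
  rw [logLR, logLR, ← Finset.sum_neg_distrib]
  exact Finset.sum_congr rfl fun k _ => by ring

variable [∀ k, IsProbabilityMeasure (P0 k)] [∀ k, IsProbabilityMeasure (P1 k)]

/-- The exponential of the sum factors over the streams, so the identity holds on rectangles with
sides in the stream σ-algebras at time `n`. These form a π-system generating the global σ-algebra at
that time. -/
theorem isLogDensity_logLR (hequiv : ∀ k, LocallyEquivalent (P0 k) (P1 k))
    (A B : Finset (Fin K)) :
    IsLogDensity (globalFiltration S) (jointLaw P0 P1 A) (jointLaw P0 P1 B)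
      (logLR P0 P1 A B) := by
  refine ⟨fun n => Finset.measurable_sum _ fun k _ => (measurable_lam P0 P1 n k).const_mul _,
    fun n E hE => ?_⟩
  have hle := (globalFiltration S).le n
  set w : Fin K → ℝ := fun k => (if k ∈ B then 1 else 0) - (if k ∈ A then 1 else 0) with hw
  set f : ∀ k, (ℕ → S k) → ℝ≥0∞ := fun k x =>
    ENNReal.ofReal (Real.exp (w k * streamLLR (P0 k) (P1 k) n x)) with hf
  have hfm : ∀ k, Measurable (f k) := fun k =>
    (Real.measurable_exp.comp (((measurable_streamLLR (P0 k) (P1 k) n).mono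
      ((streamFiltration (S k)).le n) le_rfl).const_mul _)).ennreal_ofReal
  have hprod : ∀ ω, ENNReal.ofReal (Real.exp (logLR P0 P1 A B n ω)) = ∏ k, f k (ω k) := by
    intro ω
    rw [logLR, Real.exp_sum, ENNReal.ofReal_prod_of_nonneg fun _ _ => (Real.exp_pos _).le]
    rfl
  have hmarg : ∀ k (s : Set (ℕ → S k)), MeasurableSet[streamFiltration (S k) n] s →
      (if k ∈ B then P1 k else P0 k) s = ∫⁻ x in s, f k x ∂(if k ∈ A then P1 k else P0 k) := by
    intro k s hs
    by_cases hB : k ∈ B <;> by_cases hA : k ∈ A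
    · simp [hf, hw, hA, hB]
    · simpa [hf, hw, hA, hB] using measure_eq_setLIntegral_exp_streamLLR (hequiv k) n hs
    · simpa [hf, hw, hA, hB] using measure_eq_setLIntegral_exp_neg_streamLLR (hequiv k) n hs
    · simp [hf, hw, hA, hB]
  set Q := (jointLaw P0 P1 A).withDensity fun ω => ∏ k, f k (ω k)
  have hrect : ∀ s : ∀ k, Set (ℕ → S k), (∀ k, MeasurableSet[streamFiltration (S k) n] (s k)) →
      jointLaw P0 P1 B (Set.univ.pi s) = Q (Set.univ.pi s) := by
    intro s hs
    have hs' : ∀ k, MeasurableSet (s k) := fun k => (streamFiltration (S k)).le n _ (hs k)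
    have hpi : MeasurableSet (Set.univ.pi s) := MeasurableSet.univ_pi hs'
    rw [withDensity_apply _ hpi, ← lintegral_indicator hpi]
    have hind : (Set.univ.pi s).indicator (fun ω => ∏ k, f k (ω k)) =
        fun ω => ∏ k, (s k).indicator (f k) (ω k) := by
      ext ω
      by_cases hω : ω ∈ Set.univ.pi s
      · rw [Set.indicator_of_mem hω]
        exact Finset.prod_congr rfl fun k _ =>
          (Set.indicator_of_mem (hω k (Set.mem_univ k)) _).symm
      · rw [Set.indicator_of_notMem hω]
        simp only [Set.mem_univ_pi, not_forall] at hω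
        obtain ⟨k, hk⟩ := hω
        exact (Finset.prod_eq_zero (Finset.mem_univ k) (Set.indicator_of_notMem hk _)).symm
    have him : ∀ k, Measurable ((s k).indicator (f k)) := fun k => (hfm k).indicator (hs' k)
    simp_rw [hind, jointLaw]
    -- Independence of the coordinates turns the integral of the product into the product of the
    -- marginal integrals, which `hmarg` evaluates.
    rw [ProbabilityTheory.lintegral_prod_eq_prod_lintegral_of_indepFun Finset.univ
      (fun k (ω : ∀ k, ℕ → S k) => (s k).indicator (f k) (ω k))
      (ProbabilityTheory.iIndepFun_pi fun k => (him k).aemeasurable)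
      (fun k => (him k).comp (measurable_pi_apply k))]
    rw [Measure.pi_pi]
    refine Finset.prod_congr rfl fun k _ => ?_
    rw [hmarg k (s k) (hs k), ← lintegral_indicator (hs' k)]
    exact ((measurePreserving_eval (fun k => if k ∈ A then P1 k else P0 k) k).lintegral_comp
      (him k)).symm
  simp_rw [hprod]
  rw [← withDensity_apply _ (hle _ hE)]
  refine ext_on_measurableSpace_of_generate_finite _
    (C := Set.pi Set.univ '' Set.pi Set.univ
      fun k => {s : Set (ℕ → S k) | MeasurableSet[streamFiltration (S k) n] s})
    ?_ hle ?_ ?_ ?_ hE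
  · rintro _ ⟨s, hs, rfl⟩
    exact hrect s fun k => hs k (Set.mem_univ k)
  · exact (@generateFrom_pi _ _ _ fun k => streamFiltration (S k) n).symm
  · exact @isPiSystem_pi _ _ fun k => streamFiltration (S k) n
  · rw [← Set.pi_univ Set.univ]
    exact hrect (fun _ => Set.univ) fun k => MeasurableSet.univ

end Laws

/-! ### The proposed procedure: measurability and expected decision times. -/

section Proposed

variable {K : ℕ} {S : Fin K → Type*} [∀ k, MeasurableSpace (S k)]
variable (P0 P1 : ∀ k, Measure (ℕ → S k))

theorem measurable_kthLargest_lam (n r : ℕ) :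
    Measurable[globalFiltration S n] fun ω => kthLargest (lam P0 P1 n ω) r :=
  (measurable_kthLargest r).comp (measurable_lam_vec P0 P1 n)

theorem isOptional_signalTime (l u : ℕ) (a c : ℝ) (k : Fin K) :
    IsOptional (globalFiltration S) (signalTime P0 P1 l u a c k) := by
  unfold signalTime
  split_ifs
  · exact isOptional_firstTime fun n => measurableSet_le
      ((measurable_kthLargest_lam P0 P1 n _).add_const _) (measurable_lam P0 P1 n k)
  · exact isOptional_firstTime fun n => measurableSet_le
      (Measurable.min (@measurable_const _ _ _ (globalFiltration S n) _)
        ((measurable_kthLargest_lam P0 P1 n _).add_const _)) (measurable_lam P0 P1 n k)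

theorem isOptional_noiseTime (l u : ℕ) (b d : ℝ) (k : Fin K) :
    IsOptional (globalFiltration S) (noiseTime P0 P1 l u b d k) := by
  unfold noiseTime
  split_ifs
  · exact isOptional_firstTime fun n => measurableSet_le (measurable_lam P0 P1 n k)
      ((measurable_kthLargest_lam P0 P1 n _).sub_const _)
  · exact isOptional_firstTime fun n => measurableSet_le (measurable_lam P0 P1 n k)
      (Measurable.max (@measurable_const _ _ _ (globalFiltration S n) _)
        ((measurable_kthLargest_lam P0 P1 n _).sub_const _))

theorem isSequential_proposed (l u : ℕ) (a b c d : ℝ) :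
    (proposed P0 P1 l u a b c d).IsSequential := by
  have hs := isOptional_signalTime P0 P1 l u a c
  have hn := isOptional_noiseTime P0 P1 l u b d
  have hsig : ∀ k (n : ℕ), MeasurableSet[globalFiltration S n]
      {ω | (proposed P0 P1 l u a b c d).T k ω = n ∧ k ∈ (proposed P0 P1 l u a b c d).D ω} := by
    intro k n
    -- Ties go to the signal decision: it requires only that the noise time is not before `n`,
    -- whereas the noise decision below requires the signal time to be strictly after `n`.
    have : {ω | (proposed P0 P1 l u a b c d).T k ω = n ∧
        k ∈ (proposed P0 P1 l u a b c d).D ω} =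
        ({ω | signalTime P0 P1 l u a c k ω ≤ n} \ {ω | signalTime P0 P1 l u a c k ω < n}) \
          {ω | noiseTime P0 P1 l u b d k ω < n} := by
      ext ω
      simp only [proposed, Set.mem_ofPred_eq, Set.mem_sdiff, not_lt, min_eq_left_iff]
      constructor
      · rintro ⟨h1, h2⟩
        rw [min_eq_left h2] at h1
        exact ⟨⟨h1.le, h1.ge⟩, h1 ▸ h2⟩
      · rintro ⟨⟨h1, h2⟩, h3⟩
        have h4 := h1.trans h3
        exact ⟨by rw [min_eq_left h4]; exact le_antisymm h1 h2, h4⟩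
    rw [this]
    exact ((hs k n).diff ((hs k).measurableSet_lt n)).diff ((hn k).measurableSet_lt n)
  have hnoise : ∀ k (n : ℕ), MeasurableSet[globalFiltration S n]
      {ω | (proposed P0 P1 l u a b c d).T k ω = n ∧ k ∉ (proposed P0 P1 l u a b c d).D ω} := by
    intro k n
    have : {ω | (proposed P0 P1 l u a b c d).T k ω = n ∧
        k ∉ (proposed P0 P1 l u a b c d).D ω} =
        ({ω | noiseTime P0 P1 l u b d k ω ≤ n} \ {ω | noiseTime P0 P1 l u b d k ω < n}) \
          {ω | signalTime P0 P1 l u a c k ω ≤ n} := by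
      ext ω
      simp only [proposed, Set.mem_ofPred_eq, Set.mem_sdiff, not_lt, not_le, min_eq_left_iff]
      constructor
      · rintro ⟨h1, h2⟩
        rw [min_eq_right h2.le] at h1
        exact ⟨⟨h1.le, h1.ge⟩, h1 ▸ h2⟩
      · rintro ⟨⟨h1, h2⟩, h3⟩
        have h4 := h1.trans_lt h3
        exact ⟨by rw [min_eq_right h4.le]; exact le_antisymm h1 h2, h4⟩
    rw [this]
    exact ((hn k n).diff ((hn k).measurableSet_lt n)).diff (hs k n)
  refine ⟨fun k ω => ?_, fun k n => ?_, hsig, hnoise⟩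
  · refine le_min ?_ ?_
    · unfold signalTime; split_ifs <;> exact one_le_firstTime _
    · unfold noiseTime; split_ifs <;> exact one_le_firstTime _
  · have : {ω | (proposed P0 P1 l u a b c d).T k ω = n} =
        {ω | (proposed P0 P1 l u a b c d).T k ω = n ∧ k ∈ (proposed P0 P1 l u a b c d).D ω} ∪
        {ω | (proposed P0 P1 l u a b c d).T k ω = n ∧
          k ∉ (proposed P0 P1 l u a b c d).D ω} := by
      ext ω
      simp only [Set.mem_ofPred_eq, Set.mem_union]
      tauto
    rw [this]
    exact (hsig k n).union (hnoise k n)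

theorem Procedure.IsSequential.measurable {χ : Procedure S} (h : χ.IsSequential) (k : Fin K) :
    Measurable (χ.T k) :=
  measurable_of_measurableSet_eq fun n => (globalFiltration S).le n _ (h.stopping k n)

/-- The event that at time `n + 1` the log-likelihood ratio of some stream lags behind its
asymptotic rate by at least `ε`. -/
def lagSet (I J : Fin K → ℝ) (A : Finset (Fin K)) (ε : ℝ) (n : ℕ) : Set (∀ k, ℕ → S k) :=
  ⋃ k, if k ∈ A then {ω | lam P0 P1 (n + 1) ω k / ((n + 1 : ℕ) : ℝ) ≤ I k - ε}
    else {ω | -lam P0 P1 (n + 1) ω k / ((n + 1 : ℕ) : ℝ) ≤ J k - ε}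

theorem measurableSet_lagSet (I J : Fin K → ℝ) (A : Finset (Fin K)) (ε : ℝ) (n : ℕ) :
    MeasurableSet (lagSet P0 P1 I J A ε n) := by
  have hm : ∀ k, Measurable fun ω => lam P0 P1 (n + 1) ω k := fun k =>
    (measurable_lam P0 P1 (n + 1) k).mono ((globalFiltration S).le _) le_rfl
  refine MeasurableSet.iUnion fun k => ?_
  split_ifs
  · exact measurableSet_le ((hm k).div_const _) measurable_const
  · exact measurableSet_le ((hm k).neg.div_const _) measurable_const

variable {P0 P1} in
theorem lt_lam_of_notMem_lagSet {I J : Fin K → ℝ} {A : Finset (Fin K)} {ε : ℝ} {n : ℕ}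
    {ω : ∀ k, ℕ → S k} (h : ω ∉ lagSet P0 P1 I J A ε n) {k : Fin K} (hk : k ∈ A) :
    (I k - ε) * ((n + 1 : ℕ) : ℝ) < lam P0 P1 (n + 1) ω k := by
  simp only [lagSet, Set.mem_iUnion, not_exists] at h
  have := h k
  rw [if_pos hk, Set.mem_ofPred_eq, not_le, lt_div_iff₀ (by positivity)] at this
  exact this

variable {P0 P1} in
theorem lam_lt_of_notMem_lagSet {I J : Fin K → ℝ} {A : Finset (Fin K)} {ε : ℝ} {n : ℕ}
    {ω : ∀ k, ℕ → S k} (h : ω ∉ lagSet P0 P1 I J A ε n) {k : Fin K} (hk : k ∉ A) :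
    lam P0 P1 (n + 1) ω k < -((J k - ε) * ((n + 1 : ℕ) : ℝ)) := by
  simp only [lagSet, Set.mem_iUnion, not_exists] at h
  have := h k
  rw [if_neg hk, Set.mem_ofPred_eq, not_le, lt_div_iff₀ (by positivity)] at this
  linarith

variable [∀ k, IsProbabilityMeasure (P0 k)] [∀ k, IsProbabilityMeasure (P1 k)]

theorem tsum_lagSet_lt_top {I J : Fin K → ℝ}
    (hcomplete : ∀ k, CompleteConvergence (P0 k) (P1 k) (I k) (J k)) (A : Finset (Fin K))
    {ε : ℝ} (hε : 0 < ε) : ∑' n, jointLaw P0 P1 A (lagSet P0 P1 I J A ε n) < ⊤ := by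
  have hm : ∀ n k, Measurable (streamLLR (P0 k) (P1 k) n) := fun n k =>
    (measurable_streamLLR (P0 k) (P1 k) n).mono ((streamFiltration (S k)).le _) le_rfl
  calc _ ≤ ∑' n, ∑' k : Fin K, jointLaw P0 P1 A
        (if k ∈ A then {ω | lam P0 P1 (n + 1) ω k / ((n + 1 : ℕ) : ℝ) ≤ I k - ε}
          else {ω | -lam P0 P1 (n + 1) ω k / ((n + 1 : ℕ) : ℝ) ≤ J k - ε}) :=
        ENNReal.tsum_le_tsum fun n => measure_iUnion_le _
    _ < ⊤ := by
      rw [ENNReal.tsum_comm, tsum_fintype]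
      refine ENNReal.sum_lt_top.2 fun k _ => ?_
      by_cases hk : k ∈ A
      · simp only [if_pos hk]
        refine lt_of_eq_of_lt (tsum_congr fun n => ?_) (hcomplete k ε hε).1
        exact (measurePreserving_jointLaw_of_mem P0 P1 hk).measure_preimage
          (measurableSet_le ((hm _ k).div_const _) measurable_const).nullMeasurableSet
      · simp only [if_neg hk]
        refine lt_of_eq_of_lt (tsum_congr fun n => ?_) (hcomplete k ε hε).2
        exact (measurePreserving_jointLaw_of_notMem P0 P1 hk).measure_preimage
          (measurableSet_le ((hm _ k).neg.div_const _) measurable_const).nullMeasurableSet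

/-- If no stream lags at time `n + 1`, then `λ_i` exceeds `(I i - ε) * (n + 1)`, and if `|A| = l`
the noise streams hold the `(l + 1)`-th largest below `-(R - I i - ε) * (n + 1)`. The two errors add
up to `2 * ε`, and the threshold is passed once `(R - 2 * ε) * (n + 1) ≥ h`. -/
theorem expectedTime_proposed_signal_le (I J : Fin K → ℝ) {l u : ℕ} (hl : l < K)
    (a b c d : ℝ) {A : Finset (Fin K)} (hA : A ∈ boundedClass K l u) {i : Fin K} (hi : i ∈ A)
    {R ε h : ℝ} (hR1 : A.card ≠ l → R ≤ I i) (hR2 : A.card = l → ∀ j ∉ A, R ≤ I i + J j)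
    (hε : 0 < ε) (hRε : 0 < R - 2 * ε) (hah : a ≤ h) (hch : c ≤ h) :
    expectedTime P0 P1 (proposed P0 P1 l u a b c d) i A ≤
      ⌈h / (R - 2 * ε)⌉₊ + 1 + ∑' n, jointLaw P0 P1 A (lagSet P0 P1 I J A ε n) := by
  refine lintegral_le_of_lt_subset _ _ _ (measurableSet_lagSet P0 P1 I J A ε) _ ?_
  intro n ω hn hT
  by_contra hω
  have hT' : ((n + 1 : ℕ) : ℕ∞) < signalTime P0 P1 l u a c i ω := lt_of_lt_of_le hT (min_le_left _ _)
  have hh : h ≤ (R - 2 * ε) * ((n + 1 : ℕ) : ℝ) := by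
    have := (Nat.ceil_le.1 hn)
    rwa [div_le_iff₀ hRε, mul_comm] at this
  have hn0 : (0 : ℝ) < ((n + 1 : ℕ) : ℝ) := by positivity
  have hlam := lt_lam_of_notMem_lagSet hω hi
  have hgap : A.card = l →
      kthLargest (lam P0 P1 (n + 1) ω) (l + 1) + c ≤ lam P0 P1 (n + 1) ω i := by
    intro hcard
    have : kthLargest (lam P0 P1 (n + 1) ω) (l + 1) ≤
        -((R - I i - ε) * ((n + 1 : ℕ) : ℝ)) := by
      refine kthLargest_le (A := A) (by omega) (by omega) fun j hj => ?_
      have h1 := lam_lt_of_notMem_lagSet hω hj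
      have h2 := hR2 hcard j hj
      have : (R - I i - ε) * ((n + 1 : ℕ) : ℝ) ≤ (J j - ε) * ((n + 1 : ℕ) : ℝ) := by
        gcongr; linarith
      linarith
    nlinarith
  rw [signalTime] at hT'
  split_ifs at hT' with hlu
  -- If `l = u`, then `|A| = l` necessarily, so the gap rule alone suffices.
  · exact not_of_lt_firstTime (by omega) hT' (hgap (le_antisymm (hlu ▸ hA.2) hA.1))
  · refine not_of_lt_firstTime (by omega) hT' ?_
    by_cases hcard : A.card = l
    · exact (min_le_right _ _).trans (hgap hcard)
    · refine (min_le_left _ _).trans ?_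
      have : (R - 2 * ε) * ((n + 1 : ℕ) : ℝ) ≤ (I i - ε) * ((n + 1 : ℕ) : ℝ) := by
        have := hR1 hcard
        gcongr; linarith
      linarith

/-- The mirror image: if `|A| = u`, it is the signals that hold the `u`-th largest above `(R - J j -
ε) * (n + 1)`. -/
theorem expectedTime_proposed_noise_le (I J : Fin K → ℝ) {l u : ℕ} (hu : 0 < u)
    (a b c d : ℝ) {A : Finset (Fin K)} (hA : A ∈ boundedClass K l u) {j : Fin K} (hj : j ∉ A)
    {R ε h : ℝ} (hR1 : A.card ≠ u → R ≤ J j) (hR2 : A.card = u → ∀ i ∈ A, R ≤ J j + I i)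
    (hε : 0 < ε) (hRε : 0 < R - 2 * ε) (hbh : b ≤ h) (hdh : d ≤ h) :
    expectedTime P0 P1 (proposed P0 P1 l u a b c d) j A ≤
      ⌈h / (R - 2 * ε)⌉₊ + 1 + ∑' n, jointLaw P0 P1 A (lagSet P0 P1 I J A ε n) := by
  refine lintegral_le_of_lt_subset _ _ _ (measurableSet_lagSet P0 P1 I J A ε) _ ?_
  intro n ω hn hT
  by_contra hω
  have hT' : ((n + 1 : ℕ) : ℕ∞) < noiseTime P0 P1 l u b d j ω := lt_of_lt_of_le hT (min_le_right _ _)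
  have hh : h ≤ (R - 2 * ε) * ((n + 1 : ℕ) : ℝ) := by
    have := (Nat.ceil_le.1 hn)
    rwa [div_le_iff₀ hRε, mul_comm] at this
  have hn0 : (0 : ℝ) < ((n + 1 : ℕ) : ℝ) := by positivity
  have hlam := lam_lt_of_notMem_lagSet hω hj
  have hgap : A.card = u →
      lam P0 P1 (n + 1) ω j ≤ kthLargest (lam P0 P1 (n + 1) ω) u - d := by
    intro hcard
    have : (R - J j - ε) * ((n + 1 : ℕ) : ℝ) ≤ kthLargest (lam P0 P1 (n + 1) ω) u := by
      refine le_kthLargest (A := A) (by omega) (by omega) fun i hi => ?_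
      have h1 := lt_lam_of_notMem_lagSet hω hi
      have h2 := hR2 hcard i hi
      have : (R - J j - ε) * ((n + 1 : ℕ) : ℝ) ≤ (I i - ε) * ((n + 1 : ℕ) : ℝ) := by
        gcongr; linarith
      linarith
    nlinarith
  rw [noiseTime] at hT'
  split_ifs at hT' with hlu
  · exact not_of_lt_firstTime (by omega) hT' (hgap (le_antisymm hA.2 (hlu ▸ hA.1)))
  · refine not_of_lt_firstTime (by omega) hT' ?_
    by_cases hcard : A.card = u
    · exact (hgap hcard).trans (le_max_right _ _)
    · refine le_trans ?_ (le_max_left _ _)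
      have : (R - 2 * ε) * ((n + 1 : ℕ) : ℝ) ≤ (J j - ε) * ((n + 1 : ℕ) : ℝ) := by
        have := hR1 hcard
        gcongr; linarith
      linarith

/-! ### Familywise error rates of the proposed procedure. -/

section Errors

/-- Ville's inequality with alternative `insert k A`. The alternative serves only as a change of
measure and need not belong to the class. -/
theorem measure_exists_le_lam (hequiv : ∀ k, LocallyEquivalent (P0 k) (P1 k))
    {A : Finset (Fin K)} {k : Fin K} (hk : k ∉ A) (a : ℝ) :
    jointLaw P0 P1 A {ω | ∃ n, a ≤ lam P0 P1 n ω k} ≤ ENNReal.ofReal (Real.exp (-a)) := by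
  simpa only [logLR_insert P0 P1 hk] using
    (isLogDensity_logLR P0 P1 hequiv A (insert k A)).measure_exists_le a

theorem measure_exists_lam_le (hequiv : ∀ k, LocallyEquivalent (P0 k) (P1 k))
    {A : Finset (Fin K)} {k : Fin K} (hk : k ∈ A) (b : ℝ) :
    jointLaw P0 P1 A {ω | ∃ n, lam P0 P1 n ω k ≤ -b} ≤ ENNReal.ofReal (Real.exp (-b)) := by
  have := (isLogDensity_logLR P0 P1 hequiv A (A.erase k)).measure_exists_le b
  simp only [logLR_erase P0 P1 hk] at this
  simpa only [le_neg] using this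

theorem measure_exists_le_lam_sub_lam (hequiv : ∀ k, LocallyEquivalent (P0 k) (P1 k))
    {A : Finset (Fin K)} {i j : Fin K} (hi : i ∈ A)
    (hj : j ∉ A) (c : ℝ) :
    jointLaw P0 P1 A {ω | ∃ n, c ≤ lam P0 P1 n ω j - lam P0 P1 n ω i} ≤
      ENNReal.ofReal (Real.exp (-c)) := by
  simpa only [logLR_swap P0 P1 hi hj] using
    (isLogDensity_logLR P0 P1 hequiv A (insert j (A.erase i))).measure_exists_le c

/-- A finite signal time means a crossing of `a` (only if `l ≠ u`) or a gap `c` over some member of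
`A`. Termination has to be assumed because a stream with both times infinite is placed in `D`. -/
theorem measure_mem_proposed_le (hequiv : ∀ k, LocallyEquivalent (P0 k) (P1 k))
    {l u : ℕ} {a b c d : ℝ} (hc : 0 < c) {A : Finset (Fin K)}
    (hA : l ≤ A.card) {k : Fin K} (hk : k ∉ A)
    (hT : ∀ᵐ ω ∂(jointLaw P0 P1 A), (proposed P0 P1 l u a b c d).T k ω < ⊤) :
    jointLaw P0 P1 A {ω | k ∈ (proposed P0 P1 l u a b c d).D ω} ≤
      ENNReal.ofReal ((if l = u then 0 else Real.exp (-a)) + A.card * Real.exp (-c)) := by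
  have hpos : 0 ≤ if l = u then 0 else Real.exp (-a) := by split_ifs <;> positivity
  have hsub : ∀ᵐ ω ∂(jointLaw P0 P1 A), k ∈ (proposed P0 P1 l u a b c d).D ω →
      ω ∈ (if l = u then ∅ else {ω | ∃ n, a ≤ lam P0 P1 n ω k}) ∪
        ⋃ i ∈ A, {ω | ∃ n, c ≤ lam P0 P1 n ω k - lam P0 P1 n ω i} := by
    filter_upwards [hT] with ω hω hD
    have hfin : signalTime P0 P1 l u a c k ω ≠ ⊤ := by
      have : min (signalTime P0 P1 l u a c k ω) (noiseTime P0 P1 l u b d k ω) =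
        signalTime P0 P1 l u a c k ω := hD
      rw [← this]
      exact hω.ne
    have hex : ∀ n, kthLargest (lam P0 P1 n ω) (l + 1) + c ≤ lam P0 P1 n ω k →
        ω ∈ ⋃ i ∈ A, {ω | ∃ n, c ≤ lam P0 P1 n ω k - lam P0 P1 n ω i} := by
      intro n hn
      obtain ⟨i, hi, hi'⟩ := exists_mem_of_kthLargest_add_le hk hA hc hn
      exact Set.mem_biUnion hi ⟨n, hi'⟩
    rw [signalTime] at hfin
    split_ifs at hfin ⊢ with hlu
    · obtain ⟨n, hn⟩ := exists_of_firstTime_ne_top hfin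
      exact Or.inr (hex n hn)
    · obtain ⟨n, hn⟩ := exists_of_firstTime_ne_top hfin
      rcases min_le_iff.1 hn with h | h
      · exact Or.inl ⟨n, h⟩
      · exact Or.inr (hex n h)
  refine (measure_mono_ae hsub).trans ((measure_union_le _ _).trans ?_)
  rw [ENNReal.ofReal_add hpos (by positivity), ENNReal.ofReal_mul (by positivity),
    ENNReal.ofReal_natCast]
  refine add_le_add ?_ ?_
  · split_ifs
    · simp
    · exact measure_exists_le_lam P0 P1 hequiv hk a
  · refine (measure_biUnion_finset_le _ _).trans ((Finset.sum_le_card_nsmul _ _ _ fun i hi =>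
      measure_exists_le_lam_sub_lam P0 P1 hequiv hi hk c).trans ?_)
    rw [nsmul_eq_mul]

theorem measure_notMem_proposed_le (hequiv : ∀ k, LocallyEquivalent (P0 k) (P1 k))
    {l u : ℕ} (huK : u ≤ K) {a b c d : ℝ} (hd : 0 < d)
    {A : Finset (Fin K)} (hA : A.card ≤ u) {k : Fin K} (hk : k ∈ A) :
    jointLaw P0 P1 A {ω | k ∉ (proposed P0 P1 l u a b c d).D ω} ≤
      ENNReal.ofReal ((if l = u then 0 else Real.exp (-b)) + Aᶜ.card * Real.exp (-d)) := by
  have hpos : 0 ≤ if l = u then 0 else Real.exp (-b) := by split_ifs <;> positivity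
  have hsub : {ω | k ∉ (proposed P0 P1 l u a b c d).D ω} ⊆
      (if l = u then ∅ else {ω | ∃ n, lam P0 P1 n ω k ≤ -b}) ∪
        ⋃ j ∈ Aᶜ, {ω | ∃ n, d ≤ lam P0 P1 n ω j - lam P0 P1 n ω k} := by
    intro ω hD
    -- Exclusion from `D` means that the noise time is strictly smaller than the signal time, so it
    -- is finite automatically.
    have hfin : noiseTime P0 P1 l u b d k ω ≠ ⊤ := by
      have : min (signalTime P0 P1 l u a c k ω) (noiseTime P0 P1 l u b d k ω) ≠
        signalTime P0 P1 l u a c k ω := hD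
      intro h
      rw [h] at this
      simp at this
    have hex : ∀ n, lam P0 P1 n ω k ≤ kthLargest (lam P0 P1 n ω) u - d →
        ω ∈ ⋃ j ∈ Aᶜ, {ω | ∃ n, d ≤ lam P0 P1 n ω j - lam P0 P1 n ω k} := by
      intro n hn
      obtain ⟨j, hj, hj'⟩ := exists_notMem_of_le_kthLargest_sub hk hA huK hd hn
      exact Set.mem_biUnion (Finset.mem_compl.2 hj) ⟨n, hj'⟩
    rw [noiseTime] at hfin
    split_ifs at hfin ⊢ with hlu
    · obtain ⟨n, hn⟩ := exists_of_firstTime_ne_top hfin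
      exact Or.inr (hex n hn)
    · obtain ⟨n, hn⟩ := exists_of_firstTime_ne_top hfin
      rcases le_max_iff.1 hn with h | h
      · exact Or.inl ⟨n, h⟩
      · exact Or.inr (hex n h)
  refine (measure_mono hsub).trans ((measure_union_le _ _).trans ?_)
  rw [ENNReal.ofReal_add hpos (by positivity), ENNReal.ofReal_mul (by positivity),
    ENNReal.ofReal_natCast]
  refine add_le_add ?_ ?_
  · split_ifs
    · simp
    · exact measure_exists_lam_le P0 P1 hequiv hk b
  · refine (measure_biUnion_finset_le _ _).trans ((Finset.sum_le_card_nsmul _ _ _ fun j hj =>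
      measure_exists_le_lam_sub_lam P0 P1 hequiv hk (Finset.mem_compl.1 hj) d).trans ?_)
    rw [nsmul_eq_mul]

theorem FWE1_proposed_le (hequiv : ∀ k, LocallyEquivalent (P0 k) (P1 k))
    {l u : ℕ} {a b c d : ℝ} (hc : 0 < c) {A : Finset (Fin K)}
    (hA : l ≤ A.card)
    (hT : ∀ k, ∀ᵐ ω ∂(jointLaw P0 P1 A), (proposed P0 P1 l u a b c d).T k ω < ⊤) :
    FWE1 P0 P1 (proposed P0 P1 l u a b c d) A ≤ ENNReal.ofReal (Aᶜ.card *
      ((if l = u then 0 else Real.exp (-a)) + A.card * Real.exp (-c))) := by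
  have hsub : {ω | ((proposed P0 P1 l u a b c d).D ω \ (A : Set (Fin K))).Nonempty} ⊆
      ⋃ k ∈ Aᶜ, {ω | k ∈ (proposed P0 P1 l u a b c d).D ω} := by
    rintro ω ⟨k, hk, hkA⟩
    exact Set.mem_biUnion (Finset.mem_compl.2 hkA) hk
  refine (measure_mono hsub).trans ((measure_biUnion_finset_le _ _).trans
    ((Finset.sum_le_card_nsmul _ _ _ fun k hk => measure_mem_proposed_le P0 P1 hequiv hc hA
      (Finset.mem_compl.1 hk) (hT k)).trans ?_))
  rw [nsmul_eq_mul, ENNReal.ofReal_mul (by positivity), ENNReal.ofReal_natCast]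

theorem FWE2_proposed_le (hequiv : ∀ k, LocallyEquivalent (P0 k) (P1 k))
    {l u : ℕ} (huK : u ≤ K) {a b c d : ℝ} (hd : 0 < d)
    {A : Finset (Fin K)} (hA : A.card ≤ u) :
    FWE2 P0 P1 (proposed P0 P1 l u a b c d) A ≤ ENNReal.ofReal (A.card *
      ((if l = u then 0 else Real.exp (-b)) + Aᶜ.card * Real.exp (-d))) := by
  have hsub : {ω | ((A : Set (Fin K)) \ (proposed P0 P1 l u a b c d).D ω).Nonempty} ⊆
      ⋃ k ∈ A, {ω | k ∉ (proposed P0 P1 l u a b c d).D ω} := by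
    rintro ω ⟨k, hkA, hk⟩
    exact Set.mem_biUnion hkA hk
  refine (measure_mono hsub).trans ((measure_biUnion_finset_le _ _).trans
    ((Finset.sum_le_card_nsmul _ _ _ fun k hk => measure_notMem_proposed_le P0 P1 hequiv huK hd hA
      hk).trans ?_))
  rw [nsmul_eq_mul, ENNReal.ofReal_mul (by positivity), ENNReal.ofReal_natCast]

end Errors

end Proposed

/-! ### Growth rates and the least favourable alternatives. -/

section Rates

variable {K : ℕ} {S : Fin K → Type*} [∀ k, MeasurableSpace (S k)]
variable {P0 P1 : ∀ k, Measure (ℕ → S k)}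

theorem eventually_le_mul_of_limsup_le {f : ℕ → ℝ} {I r : ℝ} (hr : I < r)
    (h : limsup (fun n : ℕ => ((f n / n : ℝ) : EReal)) atTop ≤ (I : EReal)) :
    ∀ᶠ n : ℕ in atTop, f n ≤ r * n := by
  have h1 := eventually_lt_of_limsup_lt (h.trans_lt (EReal.coe_lt_coe_iff.2 hr))
  filter_upwards [h1, eventually_ge_atTop 1] with n hn hn1
  have hn0 : (0 : ℝ) < n := by exact_mod_cast hn1
  exact ((div_lt_iff₀ hn0).1 (EReal.coe_lt_coe_iff.1 hn)).le

variable [∀ k, IsProbabilityMeasure (P0 k)] [∀ k, IsProbabilityMeasure (P1 k)]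

theorem ae_eventually_lam_le {I J : Fin K → ℝ}
    (hlimsup : ∀ k, LimsupCondition (P0 k) (P1 k) (I k) (J k)) {A : Finset (Fin K)} {k : Fin K}
    (hk : k ∈ A) {r : ℝ} (hr : I k < r) :
    ∀ᵐ ω ∂(jointLaw P0 P1 A), ∀ᶠ n : ℕ in atTop, lam P0 P1 n ω k ≤ r * n := by
  have := (measurePreserving_jointLaw_of_mem P0 P1 hk).quasiMeasurePreserving.ae (hlimsup k).1
  filter_upwards [this] with ω hω
  exact eventually_le_mul_of_limsup_le hr hω

theorem ae_eventually_neg_lam_le {I J : Fin K → ℝ}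
    (hlimsup : ∀ k, LimsupCondition (P0 k) (P1 k) (I k) (J k)) {A : Finset (Fin K)} {k : Fin K}
    (hk : k ∉ A) {r : ℝ} (hr : J k < r) :
    ∀ᵐ ω ∂(jointLaw P0 P1 A), ∀ᶠ n : ℕ in atTop, -lam P0 P1 n ω k ≤ r * n := by
  have := (measurePreserving_jointLaw_of_notMem P0 P1 hk).quasiMeasurePreserving.ae (hlimsup k).2
  filter_upwards [this] with ω hω
  exact eventually_le_mul_of_limsup_le hr hω

theorem ae_eventually_lam_sub_lam_le {I J : Fin K → ℝ}
    (hlimsup : ∀ k, LimsupCondition (P0 k) (P1 k) (I k) (J k)) {A : Finset (Fin K)} {i j : Fin K}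
    (hi : i ∈ A) (hj : j ∉ A) {r : ℝ} (hr : I i + J j < r) :
    ∀ᵐ ω ∂(jointLaw P0 P1 A), ∀ᶠ n : ℕ in atTop, lam P0 P1 n ω i - lam P0 P1 n ω j ≤ r * n := by
  have h1 : I i < I i + (r - (I i + J j)) / 2 := by linarith
  have h2 : J j < J j + (r - (I i + J j)) / 2 := by linarith
  filter_upwards [ae_eventually_lam_le hlimsup hi h1, ae_eventually_neg_lam_le hlimsup hj h2]
    with ω hω1 hω2
  filter_upwards [hω1, hω2] with n hn1 hn2
  nlinarith

/-- The asymptotic rate for the detection of the signal `i`, together with the set of signals that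
is hardest to distinguish from `A`. -/
theorem exists_signal_rate {I J : Fin K → ℝ} (hI : ∀ k, 0 < I k) (hJ : ∀ k, 0 < J k)
    (hlimsup : ∀ k, LimsupCondition (P0 k) (P1 k) (I k) (J k)) {l u : ℕ} (hl : l < K)
    {A : Finset (Fin K)} (hA : A ∈ boundedClass K l u) {i : Fin K} (hi : i ∈ A) :
    ∃ R : ℝ, 0 < R ∧ ENNReal.ofReal (I i) + minNoise J A * (if A.card = l then 1 else 0) =
        ENNReal.ofReal R ∧
      (A.card ≠ l → R ≤ I i) ∧ (A.card = l → ∀ j ∉ A, R ≤ I i + J j) ∧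
      ∃ B ∈ boundedClass K l u, i ∉ B ∧ ∀ r, R < r → ∀ᵐ ω ∂(jointLaw P0 P1 A),
        ∀ᶠ n : ℕ in atTop, logLR P0 P1 B A n ω ≤ r * n := by
  -- At the minimal size, removing `i` leaves the class, so `i` is swapped with the minimizer of `J`
  -- off `A`, which exists because `l < K`.
  by_cases hcard : A.card = l
  · have hne : (Aᶜ).Nonempty := by
      rw [← Finset.card_pos, Finset.card_compl, Fintype.card_fin]; omega
    obtain ⟨j, hj, hmin⟩ := Finset.exists_min_image Aᶜ J hne
    rw [Finset.mem_compl] at hj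
    have hmn : minNoise J A = ENNReal.ofReal (J j) :=
      le_antisymm (iInf₂_le j hj) (le_iInf₂ fun j' hj' =>
        ENNReal.ofReal_le_ofReal (hmin j' (Finset.mem_compl.2 hj')))
    refine ⟨I i + J j, add_pos (hI i) (hJ j), ?_, fun h => absurd hcard h,
      fun _ j' hj' => by have := hmin j' (Finset.mem_compl.2 hj'); linarith,
      insert j (A.erase i), ?_, ?_, fun r hr => ?_⟩
    · rw [hmn, if_pos hcard, mul_one, ENNReal.ofReal_add (hI i).le (hJ j).le]
    · have hc : (insert j (A.erase i)).card = A.card := by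
        rw [Finset.card_insert_of_notMem (fun h => hj (Finset.mem_of_mem_erase h)),
          Finset.card_erase_add_one hi]
      exact ⟨hc ▸ hA.1, hc ▸ hA.2⟩
    · rw [Finset.mem_insert]
      rintro (rfl | h)
      · exact hj hi
      · exact Finset.notMem_erase i A h
    · filter_upwards [ae_eventually_lam_sub_lam_le hlimsup hi hj hr] with ω hω
      filter_upwards [hω] with n hn
      rwa [logLR_symm, logLR_swap P0 P1 hi hj, neg_sub]
  -- If `A` is everything, `minNoise J A` is infinite, and the convention `∞ * 0 = 0` removes it.
  · refine ⟨I i, hI i, by simp [hcard], fun _ => le_rfl, fun h => absurd h hcard, A.erase i, ?_,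
      Finset.notMem_erase i A, fun r hr => ?_⟩
    · have := hA.1
      have := hA.2
      have := Finset.card_erase_add_one hi
      constructor <;> omega
    · filter_upwards [ae_eventually_lam_le hlimsup hi hr] with ω hω
      filter_upwards [hω] with n hn
      rwa [logLR_symm, logLR_erase P0 P1 hi, neg_neg]

/-- The asymptotic rate for the identification of the noise stream `j`, together with the set of
signals that is hardest to distinguish from `A`. -/
theorem exists_noise_rate {I J : Fin K → ℝ} (hI : ∀ k, 0 < I k) (hJ : ∀ k, 0 < J k)
    (hlimsup : ∀ k, LimsupCondition (P0 k) (P1 k) (I k) (J k)) {l u : ℕ} (hu : 0 < u)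
    {A : Finset (Fin K)} (hA : A ∈ boundedClass K l u) {j : Fin K} (hj : j ∉ A) :
    ∃ R : ℝ, 0 < R ∧ ENNReal.ofReal (J j) + minSignal I A * (if A.card = u then 1 else 0) =
        ENNReal.ofReal R ∧
      (A.card ≠ u → R ≤ J j) ∧ (A.card = u → ∀ i ∈ A, R ≤ J j + I i) ∧
      ∃ B ∈ boundedClass K l u, j ∈ B ∧ ∀ r, R < r → ∀ᵐ ω ∂(jointLaw P0 P1 A),
        ∀ᶠ n : ℕ in atTop, logLR P0 P1 B A n ω ≤ r * n := by
  -- At the maximal size `j` cannot be added, so it replaces the signal with the smallest `I`; `0 <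
  -- u` ensures that there is one.
  by_cases hcard : A.card = u
  · have hne : A.Nonempty := by
      rw [← Finset.card_pos]; omega
    obtain ⟨i, hi, hmin⟩ := Finset.exists_min_image A I hne
    have hmn : minSignal I A = ENNReal.ofReal (I i) :=
      le_antisymm (iInf₂_le i hi) (le_iInf₂ fun i' hi' =>
        ENNReal.ofReal_le_ofReal (hmin i' hi'))
    refine ⟨J j + I i, add_pos (hJ j) (hI i), ?_, fun h => absurd hcard h,
      fun _ i' hi' => by have := hmin i' hi'; linarith,
      insert j (A.erase i), ?_, Finset.mem_insert_self _ _, fun r hr => ?_⟩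
    · rw [hmn, if_pos hcard, mul_one, ENNReal.ofReal_add (hJ j).le (hI i).le]
    · have hc : (insert j (A.erase i)).card = A.card := by
        rw [Finset.card_insert_of_notMem (fun h => hj (Finset.mem_of_mem_erase h)),
          Finset.card_erase_add_one hi]
      exact ⟨hc ▸ hA.1, hc ▸ hA.2⟩
    · rw [add_comm] at hr
      filter_upwards [ae_eventually_lam_sub_lam_le hlimsup hi hj hr] with ω hω
      filter_upwards [hω] with n hn
      rwa [logLR_symm, logLR_swap P0 P1 hi hj, neg_sub]
  · refine ⟨J j, hJ j, by simp [hcard], fun _ => le_rfl, fun h => absurd h hcard, insert j A, ?_,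
      Finset.mem_insert_self _ _, fun r hr => ?_⟩
    · have := hA.1
      have := hA.2
      have := Finset.card_insert_of_notMem hj
      constructor <;> omega
    · filter_upwards [ae_eventually_neg_lam_le hlimsup hj hr] with ω hω
      filter_upwards [hω] with n hn
      rwa [logLR_symm, logLR_insert P0 P1 hj]

end Rates

/-! ### Asymptotics as the levels vanish. -/

section Levels

theorem eventually_levels_Ioo {δ : ℝ} (hδ : 0 < δ) :
    ∀ᶠ p in levelsToZero, p.1 ∈ Set.Ioo 0 δ ∧ p.2 ∈ Set.Ioo 0 δ :=
  (show ∀ᶠ x in 𝓝[>] (0 : ℝ), x ∈ Set.Ioo 0 δ from Ioo_mem_nhdsGT hδ).prod_mk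
    (Ioo_mem_nhdsGT hδ)

theorem tendsto_abs_log_nhdsGT_zero : Tendsto (fun x : ℝ => |Real.log x|) (𝓝[>] 0) atTop :=
  tendsto_abs_atBot_atTop.comp Real.tendsto_log_nhdsGT_zero

theorem tendsto_abs_log_fst : Tendsto (fun p : ℝ × ℝ => |Real.log p.1|) levelsToZero atTop :=
  tendsto_abs_log_nhdsGT_zero.comp tendsto_fst

theorem tendsto_abs_log_snd : Tendsto (fun p : ℝ × ℝ => |Real.log p.2|) levelsToZero atTop :=
  tendsto_abs_log_nhdsGT_zero.comp tendsto_snd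

theorem exp_neg_abs_log {x : ℝ} (hx : x ∈ Set.Ioo (0 : ℝ) 1) : Real.exp (-|Real.log x|) = x := by
  rw [abs_of_neg (Real.log_neg hx.1 hx.2), neg_neg, Real.exp_log hx.1]

theorem exp_neg_abs_log_add_log {x y : ℝ} (hx : x ∈ Set.Ioo (0 : ℝ) 1) (hy : 0 < y) :
    Real.exp (-(|Real.log x| + Real.log y)) = x / y := by
  rw [neg_add, Real.exp_add, exp_neg_abs_log hx, Real.exp_neg, Real.exp_log hy]
  rfl

theorem abs_log_pos {x : ℝ} (hx : x ∈ Set.Ioo (0 : ℝ) 1) : 0 < |Real.log x| :=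
  abs_pos.2 (Real.log_neg hx.1 hx.2).ne

/-- The conclusion of an asymptotic-optimality argument: matching lower and upper bounds. -/
theorem sim_of_bounds {E L : ℝ → ℝ → ℝ≥0∞} {x : ℝ × ℝ → ℝ} (hx : Tendsto x levelsToZero atTop)
    {R : ℝ} (hR : 0 < R)
    (hlow : ∀ ε : ℝ, 0 < ε → ε < 1 →
      ∀ᶠ p in levelsToZero, ENNReal.ofReal ((1 - ε) * x p / R) ≤ L p.1 p.2)
    (hLE : ∀ᶠ p in levelsToZero, L p.1 p.2 ≤ E p.1 p.2)
    (hupp : ∀ ε : ℝ, 0 < ε →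
      ∀ᶠ p in levelsToZero, E p.1 p.2 ≤ ENNReal.ofReal ((1 + ε) * x p / R)) :
    Sim E L ∧ Sim L (fun α β => ENNReal.ofReal (x (α, β)) / ENNReal.ofReal R) := by
  set g : ℝ × ℝ → ℝ≥0∞ := fun p => ENNReal.ofReal (x p / R) with hg
  have hpos := hx.eventually_gt_atTop 0
  have hlow' : ∀ a < (1 : ℝ≥0∞), ∀ᶠ p in levelsToZero, a < L p.1 p.2 / g p := by
    intro a ha
    obtain ⟨r, hr0, har, hr1⟩ := ENNReal.lt_iff_exists_real_btwn.1 ha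
    have hr0' : 0 < r := ENNReal.ofReal_pos.1 (lt_of_le_of_lt zero_le har)
    rw [ENNReal.ofReal_lt_one] at hr1
    filter_upwards [hlow (1 - r) (by linarith) (by linarith), hpos] with p hp hxp
    have hxR : 0 < x p / R := by positivity
    refine har.trans_le ?_
    rw [ENNReal.le_div_iff_mul_le (Or.inl (by simpa [hg] using hxR)) (Or.inl (by simp [hg])),
      hg, ← ENNReal.ofReal_mul hr0]
    convert hp using 2
    ring
  have hupp' : ∀ b > (1 : ℝ≥0∞), ∀ᶠ p in levelsToZero, E p.1 p.2 / g p < b := by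
    intro b hb
    obtain ⟨r, hr0, hr1, hrb⟩ := ENNReal.lt_iff_exists_real_btwn.1 hb
    rw [ENNReal.one_lt_ofReal] at hr1
    filter_upwards [hupp (r - 1) (by linarith), hpos] with p hp hxp
    have hxR : 0 < x p / R := by positivity
    refine lt_of_le_of_lt ?_ hrb
    refine ENNReal.div_le_of_le_mul ?_
    rw [hg, ← ENNReal.ofReal_mul hr0]
    convert hp using 2
    ring
  have hLg : Tendsto (fun p => L p.1 p.2 / g p) levelsToZero (𝓝 1) := by
    refine tendsto_order.2 ⟨hlow', fun b hb => ?_⟩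
    filter_upwards [hupp' b hb, hLE] with p hp hle
    exact (ENNReal.div_le_div_right hle _).trans_lt hp
  have hEg : Tendsto (fun p => E p.1 p.2 / g p) levelsToZero (𝓝 1) := by
    refine tendsto_order.2 ⟨fun a ha => ?_, hupp'⟩
    filter_upwards [hlow' a ha, hLE] with p hp hle
    exact hp.trans_le (ENNReal.div_le_div_right hle _)
  constructor
  · have := ENNReal.Tendsto.div hEg (Or.inl one_ne_zero) hLg (Or.inl ENNReal.one_ne_top)
    rw [div_one] at this
    refine this.congr' ?_
    filter_upwards [hpos] with p hxp
    have hxR : 0 < x p / R := by positivity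
    -- The benchmark `g p` cancels because it is positive and finite.
    rw [div_eq_mul_inv (E p.1 p.2) (g p), div_eq_mul_inv (L p.1 p.2) (g p)]
    exact ENNReal.mul_div_mul_right _ _ (by simp [hg]) (by simpa [hg] using hxR)
  · simp only [hg, ENNReal.ofReal_div_of_pos hR] at hLg
    exact hLg

/-- The constant `C` does not depend on the levels, so it is negligible against `x`. Half of `ε`
pays for the thresholds and the loss in the rate, the other half for the constants. -/
theorem eventually_le_of_ceil_bound {E : ℝ × ℝ → ℝ≥0∞} {x h : ℝ × ℝ → ℝ}
    (hx : Tendsto x levelsToZero atTop) {R : ℝ} (hR : 0 < R)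
    (hh : ∀ δ : ℝ, 0 < δ → ∀ᶠ p in levelsToZero, h p ≤ (1 + δ) * x p)
    (hE : ∀ ε : ℝ, 0 < ε → 0 < R - 2 * ε → ∃ C : ℝ≥0∞, C < ⊤ ∧
      ∀ p, E p ≤ ⌈h p / (R - 2 * ε)⌉₊ + 1 + C) {ε : ℝ} (hε : 0 < ε) :
    ∀ᶠ p in levelsToZero, E p ≤ ENNReal.ofReal ((1 + ε) * x p / R) := by
  -- The loss in the rate is chosen so that `R` becomes `R / (1 + t)`. Together with `h ≤ (1 + t) *
  -- x` this costs `(1 + t) ^ 2 ≤ 1 + 3 * t ≤ 1 + ε / 2`.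
  set t := min 1 (ε / 6) with ht
  have ht0 : 0 < t := by positivity
  have ht1 : t ≤ 1 := min_le_left _ _
  have ht2 : t ≤ ε / 6 := min_le_right _ _
  have hr : R - 2 * (R * t / (2 * (1 + t))) = R / (1 + t) := by field_simp; ring
  obtain ⟨C, hC, hEC⟩ := hE (R * t / (2 * (1 + t))) (by positivity) (by rw [hr]; positivity)
  rw [hr] at hEC
  lift C to NNReal using hC.ne
  have hlarge : ∀ᶠ p in levelsToZero, (2 + (C : ℝ)) * (2 * R / ε) ≤ x p :=
    hx.eventually_ge_atTop _
  filter_upwards [hh t ht0, hlarge, hx.eventually_gt_atTop 0] with p hp hlarge hpos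
  have hceil : (⌈h p / (R / (1 + t))⌉₊ : ℝ) ≤ (1 + ε / 2) * x p / R + 1 := by
    have hle : h p / (R / (1 + t)) ≤ (1 + ε / 2) * x p / R := by
      rw [div_div_eq_mul_div]
      refine div_le_div_of_nonneg_right ?_ hR.le
      calc h p * (1 + t) ≤ (1 + t) * x p * (1 + t) := by gcongr
        _ = (1 + t) * (1 + t) * x p := by ring
        _ ≤ _ := by gcongr; nlinarith
    exact (Nat.cast_le.2 (Nat.ceil_mono hle)).trans (Nat.ceil_lt_add_one (by positivity)).le
  have hbig : 2 + (C : ℝ) ≤ ε / 2 * x p / R := by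
    have := mul_le_mul_of_nonneg_left hlarge (show 0 ≤ ε / (2 * R) by positivity)
    calc 2 + (C : ℝ) = ε / (2 * R) * ((2 + (C : ℝ)) * (2 * R / ε)) := by field_simp
      _ ≤ _ := this
      _ = _ := by field_simp
  calc E p ≤ ⌈h p / (R / (1 + t))⌉₊ + 1 + (C : ℝ≥0∞) := hEC p
    _ = ENNReal.ofReal (⌈h p / (R / (1 + t))⌉₊ + 1 + (C : ℝ)) := by
      rw [ENNReal.ofReal_add (by positivity) C.coe_nonneg, ENNReal.ofReal_add (by positivity) one_pos.le]
      simp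
    _ ≤ _ := by
      apply ENNReal.ofReal_le_ofReal
      have : (1 + ε) * x p / R = (1 + ε / 2) * x p / R + ε / 2 * x p / R := by ring
      linarith

theorem RealSim.eventually_le {f g : ℝ → ℝ → ℝ} (h : RealSim f g)
    (hg : ∀ᶠ p in levelsToZero, 0 < g p.1 p.2) {δ : ℝ} (hδ : 0 < δ) :
    ∀ᶠ p in levelsToZero, f p.1 p.2 ≤ (1 + δ) * g p.1 p.2 := by
  filter_upwards [h.eventually_le_const (show (1 : ℝ) < 1 + δ by linarith), hg] with p hp hgp
  exact (div_le_iff₀ hgp).1 hp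

end Levels

/-! ### Lower bounds on the optimal times and membership in the error class. -/

section Optimality

variable {K : ℕ} {S : Fin K → Type*} [∀ k, MeasurableSpace (S k)]
variable {P0 P1 : ∀ k, Measure (ℕ → S k)}
variable [∀ k, IsProbabilityMeasure (P0 k)] [∀ k, IsProbabilityMeasure (P1 k)]

/-- Selecting `i` is a type-I error under `B`, with probability at most `α = exp (-|log α|)`;
missing `i` is a type-II error under `A`, and `β` has only to fall below the fixed `δ`. -/
theorem eventually_le_optimalTime_signal (hequiv : ∀ k, LocallyEquivalent (P0 k) (P1 k))
    {Pi : Set (Finset (Fin K))} {A B : Finset (Fin K)} (hA : A ∈ Pi) (hB : B ∈ Pi) {i : Fin K}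
    (hi : i ∈ A) (hiB : i ∉ B) {R : ℝ} (hR : 0 < R)
    (hlim : ∀ r, R < r → ∀ᵐ ω ∂(jointLaw P0 P1 A),
      ∀ᶠ n : ℕ in atTop, logLR P0 P1 B A n ω ≤ r * n) {ε : ℝ} (hε : 0 < ε) (hε1 : ε < 1) :
    ∀ᶠ p in levelsToZero, ENNReal.ofReal ((1 - ε) * |Real.log p.1| / R) ≤
      optimalTime P0 P1 i A p.1 p.2 Pi := by
  obtain ⟨x0, δ, hδ, hbound⟩ := (isLogDensity_logLR P0 P1 hequiv B A).exists_lintegral_ge hR hlim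
    hε hε1
  filter_upwards [tendsto_abs_log_fst.eventually_ge_atTop x0, eventually_levels_Ioo one_pos,
    eventually_levels_Ioo hδ] with p hp hp1 hpδ
  refine le_iInf₂ fun χ hχ => ?_
  refine hbound _ hp (χ.T i) {ω | i ∈ χ.D ω} (hχ.1.measurable i) (hχ.1.signal i) ?_ ?_
  · rw [exp_neg_abs_log hp1.1]
    exact (measure_mono fun ω hω => (⟨i, hω, hiB⟩ : (χ.D ω \ (B : Set (Fin K))).Nonempty)).trans (hχ.2 B hB).2.1
  · refine le_trans ?_ ((hχ.2 A hA).2.2.trans (ENNReal.ofReal_le_ofReal hpδ.2.2.le))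
    exact measure_mono fun ω hω => ⟨i, hi, hω⟩

theorem eventually_le_optimalTime_noise (hequiv : ∀ k, LocallyEquivalent (P0 k) (P1 k))
    {Pi : Set (Finset (Fin K))} {A B : Finset (Fin K)} (hA : A ∈ Pi) (hB : B ∈ Pi) {j : Fin K}
    (hj : j ∉ A) (hjB : j ∈ B) {R : ℝ} (hR : 0 < R)
    (hlim : ∀ r, R < r → ∀ᵐ ω ∂(jointLaw P0 P1 A),
      ∀ᶠ n : ℕ in atTop, logLR P0 P1 B A n ω ≤ r * n) {ε : ℝ} (hε : 0 < ε) (hε1 : ε < 1) :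
    ∀ᶠ p in levelsToZero, ENNReal.ofReal ((1 - ε) * |Real.log p.2| / R) ≤
      optimalTime P0 P1 j A p.1 p.2 Pi := by
  obtain ⟨x0, δ, hδ, hbound⟩ := (isLogDensity_logLR P0 P1 hequiv B A).exists_lintegral_ge hR hlim
    hε hε1
  filter_upwards [tendsto_abs_log_snd.eventually_ge_atTop x0, eventually_levels_Ioo one_pos,
    eventually_levels_Ioo hδ] with p hp hp1 hpδ
  refine le_iInf₂ fun χ hχ => ?_
  refine hbound _ hp (χ.T j) {ω | j ∉ χ.D ω} (hχ.1.measurable j) (hχ.1.noise j) ?_ ?_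
  · rw [exp_neg_abs_log hp1.2]
    exact (measure_mono fun ω hω => (⟨j, hjB, hω⟩ : ((B : Set (Fin K)) \ χ.D ω).Nonempty)).trans (hχ.2 B hB).2.2
  · refine le_trans ?_ ((hχ.2 A hA).2.1.trans (ENNReal.ofReal_le_ofReal hpδ.1.2.le))
    refine measure_mono fun ω hω => ⟨j, ?_, hj⟩
    simpa using hω

/-- The bounds on the expected time hold for arbitrary real thresholds and are finite for any
positive `ε < R / 2`; `R / 4` is one choice. -/
theorem ae_proposed_lt_top {I J : Fin K → ℝ} (hI : ∀ k, 0 < I k) (hJ : ∀ k, 0 < J k)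
    (hlimsup : ∀ k, LimsupCondition (P0 k) (P1 k) (I k) (J k))
    (hcomplete : ∀ k, CompleteConvergence (P0 k) (P1 k) (I k) (J k)) {l u : ℕ} (hu : 0 < u)
    (hl : l < K) (a b c d : ℝ) {A : Finset (Fin K)} (hA : A ∈ boundedClass K l u) (k : Fin K) :
    ∀ᵐ ω ∂(jointLaw P0 P1 A), (proposed P0 P1 l u a b c d).T k ω < ⊤ := by
  have hfin : expectedTime P0 P1 (proposed P0 P1 l u a b c d) k A < ⊤ := by
    by_cases hk : k ∈ A
    · obtain ⟨R, hR, -, hR1, hR2, -⟩ := exists_signal_rate hI hJ hlimsup hl hA hk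
      refine (expectedTime_proposed_signal_le P0 P1 I J hl a b c d hA hk hR1 hR2
        (ε := R / 4) (by positivity) (by linarith) (le_max_left a c) (le_max_right a c)).trans_lt ?_
      exact ENNReal.add_lt_top.2 ⟨by finiteness, tsum_lagSet_lt_top P0 P1 hcomplete A (by positivity)⟩
    · obtain ⟨R, hR, -, hR1, hR2, -⟩ := exists_noise_rate hI hJ hlimsup hu hA hk
      refine (expectedTime_proposed_noise_le P0 P1 I J hu a b c d hA hk hR1 hR2
        (ε := R / 4) (by positivity) (by linarith) (le_max_left b d) (le_max_right b d)).trans_lt ?_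
      exact ENNReal.add_lt_top.2 ⟨by finiteness, tsum_lagSet_lt_top P0 P1 hcomplete A (by positivity)⟩
  have hm : Measurable fun ω => ((proposed P0 P1 l u a b c d).T k ω : ℝ≥0∞) :=
    (measurable_of_countable (fun t : ℕ∞ => (t : ℝ≥0∞))).comp
      ((isSequential_proposed P0 P1 l u a b c d).measurable k)
  filter_upwards [ae_lt_top hm hfin.ne] with ω hω
  simpa [lt_top_iff_ne_top] using hω

theorem proposed_mem_errorClass (hequiv : ∀ k, LocallyEquivalent (P0 k) (P1 k))
    {I J : Fin K → ℝ} (hI : ∀ k, 0 < I k) (hJ : ∀ k, 0 < J k)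
    (hlimsup : ∀ k, LimsupCondition (P0 k) (P1 k) (I k) (J k))
    (hcomplete : ∀ k, CompleteConvergence (P0 k) (P1 k) (I k) (J k)) {l u : ℕ} (huK : u ≤ K)
    (hu : 0 < u) (hl : l < K) {a b c d α β : ℝ} (hc : 0 < c) (hd : 0 < d)
    (hα : ∀ A ∈ boundedClass K l u, (Aᶜ.card : ℝ) *
      ((if l = u then 0 else Real.exp (-a)) + A.card * Real.exp (-c)) ≤ α)
    (hβ : ∀ A ∈ boundedClass K l u, (A.card : ℝ) *
      ((if l = u then 0 else Real.exp (-b)) + Aᶜ.card * Real.exp (-d)) ≤ β) :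
    proposed P0 P1 l u a b c d ∈ errorClass P0 P1 α β (boundedClass K l u) := by
  refine ⟨isSequential_proposed P0 P1 l u a b c d, fun A hA => ?_⟩
  have hT := ae_proposed_lt_top hI hJ hlimsup hcomplete hu hl a b c d hA
  exact ⟨hT,
    (FWE1_proposed_le P0 P1 hequiv hc hA.1 hT).trans (ENNReal.ofReal_le_ofReal (hα A hA)),
    (FWE2_proposed_le P0 P1 hequiv huK hd hA.2).trans (ENNReal.ofReal_le_ofReal (hβ A hA))⟩

end Optimality

/-- The two contributions to the familywise error rate add up to at most the level. -/
theorem card_mul_error_le {n m N M x : ℝ} (hm : 0 ≤ m) (hx : 0 ≤ x) (hM : 0 < M)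
    (hnM : n ≤ M) (hN : 0 < N) (hnm : n + m = N) :
    n * (x / N + m * (x / (M * N))) ≤ x := by
  -- Since `n ≤ M`, the gap errors cost at most `m * x / N`, which complements the `n * x / N` of
  -- the level crossings.
  have h1 : n * (m * (x / (M * N))) ≤ m * (x / N) := by
    have : n * (m * (x / (M * N))) = n / M * (m * (x / N)) := by field_simp
    rw [this]
    exact mul_le_of_le_one_left (by positivity) ((div_le_one hM).2 hnM)
  have h2 : n * (x / N) + m * (x / N) = x := by
    rw [← add_mul, hnm]; field_simp
  nlinarith

end SeqTest

/-! ### Asymptotic optimality and the explicit thresholds. -/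

theorem theorem4p1 {K : ℕ} {S : Fin K → Type*} [∀ k, MeasurableSpace (S k)]
    (P0 P1 : ∀ k, Measure (ℕ → S k))
    [∀ k, IsProbabilityMeasure (P0 k)] [∀ k, IsProbabilityMeasure (P1 k)]
    (hequiv : ∀ k, LocallyEquivalent (P0 k) (P1 k))
    (I J : Fin K → ℝ) (hI : ∀ k, 0 < I k) (hJ : ∀ k, 0 < J k)
    (hlimsup : ∀ k, LimsupCondition (P0 k) (P1 k) (I k) (J k))
    (hcomplete : ∀ k, CompleteConvergence (P0 k) (P1 k) (I k) (J k))
    (l u : ℕ) (hlu : l ≤ u) (huK : u ≤ K) (hu : 0 < u) (hl : l < K) :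
    -- asymptotic optimality for all admissible thresholds
    (∀ a b c d : ℝ → ℝ → ℝ,
      (∀ α ∈ Set.Ioo (0 : ℝ) 1, ∀ β ∈ Set.Ioo (0 : ℝ) 1,
        0 < a α β ∧ 0 < b α β ∧ 0 < c α β ∧ 0 < d α β ∧
        proposed P0 P1 l u (a α β) (b α β) (c α β) (d α β)
          ∈ errorClass P0 P1 α β (boundedClass K l u)) →
      RealSim a (fun α _ => |Real.log α|) → RealSim c (fun α _ => |Real.log α|) →
      RealSim b (fun _ β => |Real.log β|) → RealSim d (fun _ β => |Real.log β|) →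
      ∀ A ∈ boundedClass K l u,
        (∀ i ∈ A,
          Sim (fun α β => expectedTime P0 P1
                (proposed P0 P1 l u (a α β) (b α β) (c α β) (d α β)) i A)
              (fun α β => optimalTime P0 P1 i A α β (boundedClass K l u)) ∧
          Sim (fun α β => optimalTime P0 P1 i A α β (boundedClass K l u))
              (fun α _ => ENNReal.ofReal |Real.log α| /
                (ENNReal.ofReal (I i) + minNoise J A * (if A.card = l then 1 else 0)))) ∧
        (∀ j ∉ A,
          Sim (fun α β => expectedTime P0 P1
                (proposed P0 P1 l u (a α β) (b α β) (c α β) (d α β)) j A)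
              (fun α β => optimalTime P0 P1 j A α β (boundedClass K l u)) ∧
          Sim (fun α β => optimalTime P0 P1 j A α β (boundedClass K l u))
              (fun _ β => ENNReal.ofReal |Real.log β| /
                (ENNReal.ofReal (J j) + minSignal I A * (if A.card = u then 1 else 0))))) ∧
    -- the explicit thresholds are admissible
    (∀ α ∈ Set.Ioo (0 : ℝ) 1, ∀ β ∈ Set.Ioo (0 : ℝ) 1,
      (l = u → ∀ a b : ℝ,
        proposed P0 P1 l u a b
            (|Real.log α| + Real.log ((l : ℝ) * ((K : ℝ) - l)))
            (|Real.log β| + Real.log ((l : ℝ) * ((K : ℝ) - l)))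
          ∈ errorClass P0 P1 α β (boundedClass K l u)) ∧
      (l < u →
        proposed P0 P1 l u
            (|Real.log α| + Real.log K) (|Real.log β| + Real.log K)
            (|Real.log α| + Real.log (((K : ℝ) - l) * K))
            (|Real.log β| + Real.log ((u : ℝ) * K))
          ∈ errorClass P0 P1 α β (boundedClass K l u))) := by
  refine ⟨fun a b c d hmem ha hc hb hd A hA => ⟨fun i hi => ?_, fun j hj => ?_⟩,
    fun α hα β hβ => ⟨fun hlu' a b => ?_, fun hlu' => ?_⟩⟩
  · obtain ⟨R, hR, hReq, hR1, hR2, B, hB, hiB, hlim⟩ :=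
      exists_signal_rate hI hJ hlimsup hl hA hi
    rw [hReq]
    refine sim_of_bounds (x := fun p => |Real.log p.1|) tendsto_abs_log_fst hR
      (fun ε hε hε1 => eventually_le_optimalTime_signal hequiv hA hB hi hiB hR hlim hε hε1) ?_
      (fun ε hε => eventually_le_of_ceil_bound
        (h := fun p => max (a p.1 p.2) (c p.1 p.2)) tendsto_abs_log_fst hR ?_ ?_ hε)
    · filter_upwards [eventually_levels_Ioo one_pos] with p hp
      exact iInf₂_le _ (hmem p.1 hp.1 p.2 hp.2).2.2.2.2
    · intro δ hδ
      have hpos := tendsto_abs_log_fst.eventually_gt_atTop 0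
      filter_upwards [ha.eventually_le hpos hδ, hc.eventually_le hpos hδ] with p h1 h2
      exact max_le h1 h2
    · intro ε' hε' hRε
      exact ⟨_, tsum_lagSet_lt_top P0 P1 hcomplete A hε', fun p =>
        expectedTime_proposed_signal_le P0 P1 I J hl _ _ _ _ hA hi hR1 hR2 hε' hRε
          (le_max_left _ _) (le_max_right _ _)⟩
  · obtain ⟨R, hR, hReq, hR1, hR2, B, hB, hjB, hlim⟩ :=
      exists_noise_rate hI hJ hlimsup hu hA hj
    rw [hReq]
    refine sim_of_bounds (x := fun p => |Real.log p.2|) tendsto_abs_log_snd hR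
      (fun ε hε hε1 => eventually_le_optimalTime_noise hequiv hA hB hj hjB hR hlim hε hε1) ?_
      (fun ε hε => eventually_le_of_ceil_bound
        (h := fun p => max (b p.1 p.2) (d p.1 p.2)) tendsto_abs_log_snd hR ?_ ?_ hε)
    · filter_upwards [eventually_levels_Ioo one_pos] with p hp
      exact iInf₂_le _ (hmem p.1 hp.1 p.2 hp.2).2.2.2.2
    · intro δ hδ
      have hpos := tendsto_abs_log_snd.eventually_gt_atTop 0
      filter_upwards [hb.eventually_le hpos hδ, hd.eventually_le hpos hδ] with p h1 h2
      exact max_le h1 h2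
    · intro ε' hε' hRε
      exact ⟨_, tsum_lagSet_lt_top P0 P1 hcomplete A hε', fun p =>
        expectedTime_proposed_noise_le P0 P1 I J hu _ _ _ _ hA hj hR1 hR2 hε' hRε
          (le_max_left _ _) (le_max_right _ _)⟩
  · subst hlu'
    have hl1 : (1 : ℝ) ≤ l := by exact_mod_cast hu
    have hKl : (1 : ℝ) ≤ (K : ℝ) - l := by
      have : (l : ℝ) + 1 ≤ K := by exact_mod_cast hl
      linarith
    -- This makes the logarithm nonnegative, hence the thresholds positive.
    have hprod : 1 ≤ (l : ℝ) * ((K : ℝ) - l) := by nlinarith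
    have hlog := Real.log_nonneg hprod
    have hα0 := abs_log_pos hα
    have hβ0 := abs_log_pos hβ
    have hcard : ∀ A ∈ boundedClass K l l, (A.card : ℝ) = l ∧ (Aᶜ.card : ℝ) = (K : ℝ) - l := by
      intro A hA
      have : A.card = l := le_antisymm hA.2 hA.1
      refine ⟨by exact_mod_cast this, ?_⟩
      rw [Finset.card_compl, Fintype.card_fin, this, Nat.cast_sub hl.le]
    refine proposed_mem_errorClass hequiv hI hJ hlimsup hcomplete huK hu hl (by linarith)
      (by linarith) ?_ ?_
    -- There are exactly `l * (K - l)` pairs of a signal and a noise stream, so the union bound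
    -- equals `α`.
    · intro A hA
      rw [(hcard A hA).1, (hcard A hA).2, if_pos rfl,
        exp_neg_abs_log_add_log hα (by linarith)]
      apply le_of_eq
      field_simp
      ring
    · intro A hA
      rw [(hcard A hA).1, (hcard A hA).2, if_pos rfl,
        exp_neg_abs_log_add_log hβ (by linarith)]
      apply le_of_eq
      field_simp
      ring
  · have hK1 : (1 : ℝ) ≤ K := by exact_mod_cast (show 1 ≤ K by omega)
    have hu1 : (1 : ℝ) ≤ u := by exact_mod_cast hu
    have hKl : (1 : ℝ) ≤ (K : ℝ) - l := by
      have : (l : ℝ) + 1 ≤ K := by exact_mod_cast hl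
      linarith
    have hlog1 : 0 ≤ Real.log (((K : ℝ) - l) * K) := Real.log_nonneg (by nlinarith)
    have hlog2 : 0 ≤ Real.log ((u : ℝ) * K) := Real.log_nonneg (by nlinarith)
    have hα0 := abs_log_pos hα
    have hβ0 := abs_log_pos hβ
    have hcard : ∀ A : Finset (Fin K), (Aᶜ.card : ℝ) + (A.card : ℝ) = K := by
      intro A
      have := Finset.card_compl_add_card A
      rw [Fintype.card_fin] at this
      exact_mod_cast this
    refine proposed_mem_errorClass hequiv hI hJ hlimsup hcomplete huK hu hl (by linarith)
      (by linarith) ?_ ?_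
    · intro A hA
      rw [if_neg hlu'.ne, exp_neg_abs_log_add_log hα (by positivity),
        exp_neg_abs_log_add_log hα (by positivity)]
      have hAl : (l : ℝ) ≤ A.card := by exact_mod_cast hA.1
      -- Here `n = |Aᶜ|` and `M = K - l`; for the type-II error below, `n = |A|` and `M = u`.
      exact card_mul_error_le (by positivity) hα.1.le (by linarith)
        (by linarith [hcard A]) (by linarith) (hcard A)
    · intro A hA
      rw [if_neg hlu'.ne, exp_neg_abs_log_add_log hβ (by positivity),
        exp_neg_abs_log_add_log hβ (by positivity)]
      have hAu : (A.card : ℝ) ≤ u := by exact_mod_cast hA.2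
      exact card_mul_error_le (by positivity) hβ.1.le (by linarith)
        hAu (by linarith) (by rw [add_comm]; exact hcard A)
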